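/- **Setting.** Let $\Omega$ be a set of objects and $F$ a finite set of flaws, each flaw $f\in F$ being a non-empty subset of $\Omega$; write $F_\sigma=\{f\in F:\sigma\in f\}$ and call $\sigma$ flawless if $F_\sigma=\varnothing$. For each $\sigma\in\Omega$ and $f\in F_\sigma$ let $\rho(\cdot\,|f,\sigma)$ be a probability distribution on $\Omega$ with support $A(f,\sigma)$; write $\sigma\stackrel{f}{\to}\sigma'$ if $f\in F_\sigma$ and $\sigma'\in A(f,\sigma)$. Let $\omega$ be a probability distribution on $\Omega$ with $\omega(\sigma)>0$ for all $\sigma$. Let $\sim$ be a symmetric relation on $F$ (loops allowed), $\Gamma(f)=\{g: f\sim g\}$, and assume that $(F,\sim)$ is a potential causality graph: $F_{\sigma'}\subseteq (F_\sigma\setminus\{f\})\cup\Gamma(f)$ whenever $\sigma\stackrel{f}{\to}\sigma'$. For $I\subseteq F$ put $\Gamma^+(I)=I\cup\bigcup_{f\in I}\Gamma(f)$. A set of flaws is independent if no two distinct members are related by $\sim$; $\mathrm{Ind}(S)$ is the family of independent subsets of $S\subseteq F$. **Algorithm 1.** Sample $\sigma$ from an arbitrary initial distribution $\omega^{\rm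 init}$; while $F_\sigma\neq\varnothing$, select $f\in F_\sigma$ by a strategy $\Lambda$ (a distribution on $F_\sigma$ that may depend on the entire past history), sample $\sigma'$ from $\rho(\cdot\,|f,\sigma)$ and set $\sigma\leftarrow\sigma'$. Each iteration is one step. For a permutation $\pi$ of $F$, the $\pi$-stable strategy proceeds in rounds: a round starts with $I=\varnothing$; while $F_\sigma\setminus\Gamma^+(I)\ne\varnothing$, it selects the $\pi$-lowest flaw $f$ of this set, which is then resampled and added to $I$; when the set is empty the round ends, and a new one starts if $F_\sigma\ne\varnothing$. **Commutativity.** $(\rho,\sim)$ is *weakly commutative* if there is an injective map $\mathrm{SWAP}$ that sends each walk $\sigma_1\stackrel{f}{\to}\sigma_2\stackrel{g}{\to}\sigma_3$ with $f\nsim g$ to a walk of the form $\sigma_1\stackrel{g}{\to}\sigma_2'\stackrel{f}{\to}\sigma_3$; it is *strongly commutative* if $\mathrm{SWAP}$ can moreover be chosen such that $\rho(\sigma_2|f,\sigma_1)\rho(\sigma_3|g,\sigma_2)=\rho(\sigma_2'|g,\sigma_1)\rho(\sigma_3|f,\sigma_2')$ always holds. $\rho$ is *atomic* if for all $f,\sigma'$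 there is at most one $\sigma$ with $\sigma\stackrel{f}{\to}\sigma'$. **Theorem.** Let $\theta\in(0,1)$ and let $\lambda\in\mathbb R^F$ satisfy $$\lambda_f\ \ge\sum_{\sigma\in f:\ \sigma'\in A(f,\sigma)}\rho(\sigma'|f,\sigma)\frac{\omega(\sigma)}{\omega(\sigma')}\qquad\text{for all } f\in F,\ \sigma'\in\Omega .$$ Suppose that one of the following two conditions holds. * (Cluster expansion) There are $\mu_f>0$ ($f\in F$) with $\frac{\lambda_f}{\mu_f}\sum_{S\in\mathrm{Ind}(\Gamma(f))}\prod_{g\in S}\mu_g\le\theta$ for all $f\in F$. In this case put $\mu(R)=\prod_{f\in R}\mu_f$. * (Shearer) There is $p\in\mathbb R^F$ with $\lambda_f\le\theta p_f$ for all $f\in F$, such that the numbers $q_S=\sum_{I:\,S\subseteq I\in\mathrm{Ind}(F)}(-1)^{|I|-|S|}\prod_{f\in I}p_f$ satisfy $q_S\ge0$ for all $S\subseteq F$ and $q_\varnothing>0$. In this case put $\mu(R)=q_R/q_\varnothing$. Suppose also that one of the following holds: (a) $\Lambda$ is the $\pi$-stable strategy for some permutation $\pi$ of $F$; (b) $(\rho,\sim)$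 is weakly commutative and $\rho$ is atomic; (c) $(\rho,\sim)$ is strongly commutative. In (b) and (c) the strategy $\Lambda$ is arbitrary. Let $$\gamma^{\rm init}=\sup_{\sigma\in\Omega}\frac{\omega^{\rm init}(\sigma)}{\omega(\sigma)},\qquad \mathrm{Ind}^{\rm init}=\begin{cases}\bigcup_{\sigma:\,\omega^{\rm init}(\sigma)>0}\mathrm{Ind}(F_\sigma)&\text{in cases (a), (b)},\\ \mathrm{Ind}(F)&\text{in case (c)},\end{cases}$$ and assume $\gamma^{\rm init}<\infty$ (automatic if $\Omega$ is finite, when the supremum is a maximum). Put $$T=\frac{1}{\log\theta^{-1}}\Big(\log\gamma^{\rm init}+\log\sum_{R\in\mathrm{Ind}^{\rm init}}\mu(R)\Big).$$ Then for every real $r$, Algorithm 1 produces a flawless object in fewer than $T+r$ steps with probability at least $1-\theta^r$. -/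

import Mathlib

open scoped ENNReal

noncomputable section

namespace LLL

/-- Flaws (non-empty sets of objects, indexed by `F`) together with the resampling oracles:
`rho f σ` is the distribution `ρ(· | f, σ)`. Only its values at objects `σ` in which the flaw `f`
is present are ever used. -/
structure Oracles (Ω F : Type*) where
  flaw : F → Set Ω
  flaw_nonempty : ∀ f, (flaw f).Nonempty
  rho : F → Ω → PMF Ω

variable {Ω F : Type*}

namespace Oracles

/-- The set `F_σ` of flaws that are present in `σ`. -/
def present (S : Oracles Ω F) (σ : Ω) : Set F := {f | σ ∈ S.flaw f}

/-- `σ` is flawless if no flaw is present in it. -/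
def Flawless (S : Oracles Ω F) (σ : Ω) : Prop := S.present σ = ∅

/-- The actions `A(f, σ)`: the support of `ρ(· | f, σ)`. -/
def actions (S : Oracles Ω F) (f : F) (σ : Ω) : Set Ω := (S.rho f σ).support

/-- `σ →[f] σ'` is a valid walk of length one. -/
def Step (S : Oracles Ω F) (f : F) (σ σ' : Ω) : Prop :=
  f ∈ S.present σ ∧ σ' ∈ S.actions f σ

/-- Atomicity: for all `f` and `σ'` there is at most one `σ` with `σ →[f] σ'`. -/
def Atomic (S : Oracles Ω F) : Prop :=
  ∀ f σ' σ₁ σ₂, S.Step f σ₁ σ' → S.Step f σ₂ σ' → σ₁ = σ₂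

end Oracles

/-- The neighbours `Γ(f)` of a flaw; `f` itself belongs to `Γ(f)` iff `f ∼ f`. -/
def nbr (adj : F → F → Prop) (f : F) : Set F := {g | adj f g}

/-- `Γ⁺(I)`: the members of `I` and all their neighbours. -/
def nbrPlus (adj : F → F → Prop) (I : Set F) : Set F := {g | ∃ f ∈ I, g = f ∨ g ∈ nbr adj f}

/-- `(F, ∼)` is an (undirected) potential causality graph for the resampling oracles. -/
structure IsPotentialCausalityGraph (S : Oracles Ω F) (adj : F → F → Prop) : Prop where
  symm : ∀ f g, adj f g → adj g f
  causality : ∀ f σ σ', S.Step f σ σ' → S.present σ' ⊆ (S.present σ \ {f}) ∪ nbr adj f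

/-- A set of flaws is independent if no two distinct members are adjacent (loops are ignored). -/
def Indep (adj : F → F → Prop) (T : Set F) : Prop := T.Pairwise fun f g => ¬ adj f g

open Classical in
/-- `Ind(S)`: the independent subsets of `S`. -/
def indSets [Fintype F] (adj : F → F → Prop) (S : Set F) : Finset (Finset F) :=
  Finset.univ.filter fun T => (T : Set F) ⊆ S ∧ Indep adj (T : Set F)

/-! ### Commutativity -/

/-- Walks `σ₁ →[f] σ₂ →[g] σ₃` with `f ≁ g`. -/
structure SwapWalk (S : Oracles Ω F) (adj : F → F → Prop) where
  (σ₁ : Ω) (f : F) (σ₂ : Ω) (g : F) (σ₃ : Ω)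
  step₁ : S.Step f σ₁ σ₂
  step₂ : S.Step g σ₂ σ₃
  not_adj : ¬ adj f g

/-- `swap` is an injective map sending each walk `σ₁ →[f] σ₂ →[g] σ₃` with `f ≁ g` to a walk
of the form `σ₁ →[g] σ₂' →[f] σ₃`. -/
structure IsSwap {S : Oracles Ω F} {adj : F → F → Prop}
    (swap : SwapWalk S adj → SwapWalk S adj) : Prop where
  first : ∀ τ, (swap τ).σ₁ = τ.σ₁
  flaw₁ : ∀ τ, (swap τ).f = τ.g
  flaw₂ : ∀ τ, (swap τ).g = τ.f
  last : ∀ τ, (swap τ).σ₃ = τ.σ₃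
  injective : Function.Injective swap

def WeaklyCommutative (S : Oracles Ω F) (adj : F → F → Prop) : Prop :=
  ∃ swap : SwapWalk S adj → SwapWalk S adj, IsSwap swap

/-- The probability `ρ(σ₂ | f, σ₁) ρ(σ₃ | g, σ₂)` of the two resampling steps. -/
def SwapWalk.prob {S : Oracles Ω F} {adj : F → F → Prop} (τ : SwapWalk S adj) : ℝ≥0∞ :=
  S.rho τ.f τ.σ₁ τ.σ₂ * S.rho τ.g τ.σ₂ τ.σ₃

def StronglyCommutative (S : Oracles Ω F) (adj : F → F → Prop) : Prop :=
  ∃ swap : SwapWalk S adj → SwapWalk S adj, IsSwap swap ∧ ∀ τ, τ.prob = (swap τ).prob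

/-! ### The algorithm -/

/-- Execution histories: the initial object, and then the addressed flaws and the objects
reached. -/
inductive History (Ω F : Type*) where
  | start (σ : Ω) : History Ω F
  | step (h : History Ω F) (f : F) (σ : Ω) : History Ω F

namespace History

/-- The current object. -/
def last : History Ω F → Ω
  | start σ => σ
  | step _ _ σ => σ

/-- The number of steps made so far. -/
def steps : History Ω F → ℕ
  | start _ => 0
  | step h _ _ => h.steps + 1

end History

/-- A (randomized) flaw selection strategy: a distribution over the flaws present in the current
object, which may depend on the entire execution history. -/
structure Strategy (S : Oracles Ω F) where
  select : (h : History Ω F) → ¬ S.Flawless h.last → PMF F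
  select_present : ∀ h hne, (select h hne).support ⊆ S.present h.last

open Classical in
/-- One iteration: if the current object has a flaw, one is selected and resampled; otherwise the
algorithm has terminated and nothing changes. -/
def iteration (S : Oracles Ω F) (Λ : Strategy S) (h : History Ω F) : PMF (History Ω F) :=
  if hne : ¬ S.Flawless h.last then
    (Λ.select h hne).bind fun f => (S.rho f h.last).map fun σ' => h.step f σ'
  else PMF.pure h

/-- The law of the execution history after (at most) `n` steps. -/
def run (S : Oracles Ω F) (Λ : Strategy S) (ωinit : PMF Ω) : ℕ → PMF (History Ω F)
  | 0 => ωinit.map History.start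
  | n + 1 => (run S Λ ωinit n).bind (iteration S Λ)

/-- The probability that the algorithm terminates with a flawless object after fewer than `x`
steps. The events for the executions cut at time `n` increase with `n`, so the supremum is the
probability for the uncut execution. -/
def probFewerSteps (S : Oracles Ω F) (Λ : Strategy S) (ωinit : PMF Ω) (x : ℝ) : ℝ≥0∞ :=
  ⨆ n : ℕ, (run S Λ ωinit n).toOuterMeasure {h | S.Flawless h.last ∧ (h.steps : ℝ) < x}

/-! ### The `π`-stable strategy -/

open Classical in
/-- The set `I` of flaws already addressed in the current round. A round ends as soon as
`F_σ \ Γ⁺(I)` is empty, and then a new one starts with `I = ∅`. -/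
def roundSet (S : Oracles Ω F) (adj : F → F → Prop) : History Ω F → Set F
  | .start _ => ∅
  | .step h f σ =>
      if (S.present σ \ nbrPlus adj (insert f (roundSet S adj h))).Nonempty then
        insert f (roundSet S adj h)
      else ∅

/-- `F_σ \ Γ⁺(I)`, the flaws among which the next one is picked. -/
def eligible (S : Oracles Ω F) (adj : F → F → Prop) (h : History Ω F) : Set F :=
  S.present h.last \ nbrPlus adj (roundSet S adj h)

/-- The strategy always selects the lowest flaw of `F_σ \ Γ⁺(I)` in the order given by `π`. -/
def IsPiStable [Fintype F] (S : Oracles Ω F) (adj : F → F → Prop)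
    (π : F ≃ Fin (Fintype.card F)) (Λ : Strategy S) : Prop :=
  ∀ h hne, ∀ f ∈ (Λ.select h hne).support,
    f ∈ eligible S adj h ∧ ∀ g ∈ eligible S adj h, π f ≤ π g

/-! ### Algorithmic LLL conditions -/

/-- `λ_f ≥ ∑_{σ ∈ f : σ' ∈ A(f,σ)} ρ(σ' | f, σ) ω(σ) / ω(σ')` for all `f` and `σ'`. -/
def FlawCharges (S : Oracles Ω F) (ω : PMF Ω) (lam : F → ℝ) : Prop :=
  ∀ f σ', ∑' σ : {σ // S.Step f σ σ'}, S.rho f σ σ' * (ω σ / ω σ') ≤ ENNReal.ofReal (lam f)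

/-- The cluster expansion condition `(λ_f / μ_f) ∑_{T ∈ Ind(Γ(f))} μ(T) ≤ θ`, where `μ > 0`. -/
def ClusterExpansion [Fintype F] (adj : F → F → Prop) (θ : ℝ) (lam μ : F → ℝ) : Prop :=
  (∀ f, 0 < μ f) ∧ ∀ f, lam f / μ f * ∑ T ∈ indSets adj (nbr adj f), ∏ g ∈ T, μ g ≤ θ

open Classical in
/-- `q_R(p) = ∑_{I : R ⊆ I ∈ Ind(F)} (-1)^{|I| - |R|} p^I`. -/
def shearerQ [Fintype F] (adj : F → F → Prop) (p : F → ℝ) (R : Finset F) : ℝ :=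
  ∑ I ∈ (indSets adj Set.univ).filter (fun I => R ⊆ I),
    (-1) ^ (I.card - R.card) * ∏ f ∈ I, p f

/-- Shearer's condition for the vector `p`. -/
def ShearerVector [Fintype F] (adj : F → F → Prop) (p : F → ℝ) : Prop :=
  (∀ R, 0 ≤ shearerQ adj p R) ∧ 0 < shearerQ adj p ∅

/-! ### The bound -/

/-- `γ^init = max_σ ω^init(σ) / ω(σ)`. -/
def gammaInit (ω ωinit : PMF Ω) : ℝ≥0∞ := ⨆ σ, ωinit σ / ω σ

open Classical in
/-- `⋃_{σ ∈ supp ω^init} Ind(F_σ)`. -/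
def indInit [Fintype F] (S : Oracles Ω F) (adj : F → F → Prop) (ωinit : PMF Ω) :
    Finset (Finset F) :=
  Finset.univ.filter fun R => ∃ σ ∈ ωinit.support, R ∈ indSets adj (S.present σ)

/-- `T = (log γ^init + log ∑_{R ∈ Ind^init} μ(R)) / log θ⁻¹`. -/
def bigT (ω ωinit : PMF Ω) (θ : ℝ) (μ : Finset F → ℝ) (Ind : Finset (Finset F)) : ℝ :=
  1 / Real.log θ⁻¹ * (Real.log (gammaInit ω ωinit).toReal + Real.log (∑ R ∈ Ind, μ R))

end LLL

end

/-!
The proof charges executions to words of flaws. For a charge kernel `K f σ σ'`, which dominates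
`ρ(σ' | f, σ) ω(σ) / ω(σ')` and has column sums at most `λ_f`, the walks with flaw sequence
`f₁ … fₙ` have total charge at most `λ_{f₁} ⋯ λ_{fₙ}`, because the column sums telescope from the
first step on (`IsChargeKernel.tsum_wordCharge_le`). Hence the probability that the algorithm
makes `n` steps is at most `γ^init` times the sum of the weights `λ_{f₁} ⋯ λ_{fₙ}` of a family of
words that suffices to record all executions.

For the stable strategy the words that occur are the concatenations of independent sets
`I₁, I₂, …` with `I₁ ∈ Ind^init` and `Iₖ₊₁ ⊆ Γ(Iₖ)`, each listed in increasing order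
(`cons_mem_stableWords`). For commutative oracles, the kernels of non-adjacent flaws commute
(`tsum_kernel_comm`), so the charge of a word depends only on its trace, that is, on the word up to
exchanging consecutive non-adjacent letters. The first flaw selected by a strategy is a function of
the history, and trace monoids are left cancellative (`TraceEq.cons_cancel`), so by induction on
the number of steps every trace has to be counted only once, whatever the strategy is
(`survival_le`). By causality each trace that occurs has a Foata normal form `I₁ I₂ …` of the kind
above (`Feasible.exists_layered`). Under atomicity and weak commutativity one takes
`K f σ σ' = λ_f` on all possible steps, so that the number of walks is all that `SWAP` has to
preserve; under strong commutativity one takes the reweighted probabilities themselves.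

It remains to bound the total weight of the sequences `I₁, I₂, …` with `n` letters by
`θⁿ ∑ μ(R)`, the sum being over the admissible first layers (`tsum_layerWeight_le`). This is an
induction on `n` based on `λ^I ∑_{J ∈ Ind(Γ(I))} μ(J) ≤ θ^|I| μ(I)`. The inequality follows from
the cluster expansion condition by submultiplicativity of the sum over independent sets, and from
Shearer's condition by the identity `q_I = p^I ∑_{J ∈ Ind(Γ⁺(I))} q_J` (`shearerQ_eq`).
-/

noncomputable section

namespace LLL

/-! ### Words of flaws up to commutation -/

section Traces

variable {F : Type*} {adj : F → F → Prop}

/-- Trace equivalence of words of flaws: the congruence generated by exchanging two consecutive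
letters that are not adjacent. -/
inductive TraceEq (adj : F → F → Prop) : List F → List F → Prop
  | refl (W : List F) : TraceEq adj W W
  | swap {f g : F} (W : List F) : ¬ adj f g → TraceEq adj (f :: g :: W) (g :: f :: W)
  | cons (f : F) {V W : List F} : TraceEq adj V W → TraceEq adj (f :: V) (f :: W)
  | trans {U V W : List F} : TraceEq adj U V → TraceEq adj V W → TraceEq adj U W

namespace TraceEq

theorem symm (hs : ∀ f g, adj f g → adj g f) {V W : List F} (h : TraceEq adj V W) :
    TraceEq adj W V := by
  induction h with
  | refl W => exact refl W
  | swap W hfg => exact swap W fun h => hfg (hs _ _ h)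
  | cons f _ ih => exact cons f ih
  | trans _ _ ih₁ ih₂ => exact trans ih₂ ih₁

theorem perm {V W : List F} (h : TraceEq adj V W) : V.Perm W := by
  induction h with
  | refl W => exact .refl W
  | swap W _ => exact .swap _ _ W
  | cons f _ ih => exact .cons f ih
  | trans _ _ ih₁ ih₂ => exact .trans ih₁ ih₂

theorem append_left (A : List F) {V W : List F} (h : TraceEq adj V W) :
    TraceEq adj (A ++ V) (A ++ W) := by
  induction A with
  | nil => exact h
  | cons f A ih => exact cons f ih

theorem append_right {V W : List F} (h : TraceEq adj V W) (B : List F) :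
    TraceEq adj (V ++ B) (W ++ B) := by
  induction h with
  | refl W => exact refl _
  | swap W hfg => exact swap (W ++ B) hfg
  | cons f _ ih => exact cons f ih
  | trans _ _ ih₁ ih₂ => exact trans ih₁ ih₂

theorem erase [DecidableEq F] {V W : List F} (h : TraceEq adj V W) (x : F) :
    TraceEq adj (V.erase x) (W.erase x) := by
  induction h with
  | refl W => exact refl _
  | @swap f g W hfg =>
    by_cases hfx : f = x <;> by_cases hgx : g = x
    · subst hfx; subst hgx; exact refl _
    · subst hfx; simp [hgx]; exact refl _
    · subst hgx; simp [hfx]; exact refl _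
    · simpa [List.erase_cons, hfx, hgx] using swap _ hfg
  | @cons f V W h ih =>
    by_cases hfx : f = x
    · subst hfx; simpa using h
    · simpa [List.erase_cons, hfx] using cons f ih
  | trans _ _ ih₁ ih₂ => exact trans ih₁ ih₂

/-- Trace monoids are left cancellative. -/
theorem cons_cancel {f : F} {V W : List F} (h : TraceEq adj (f :: V) (f :: W)) :
    TraceEq adj V W := by
  classical
  simpa using h.erase f

/-- The order in which the members of an independent set are listed is irrelevant. -/
theorem of_perm {A B : List F} (hAB : A.Perm B) (hA : Indep adj {f | f ∈ A}) :
    TraceEq adj A B := by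
  induction hAB with
  | nil => exact refl _
  | @cons f A B _ ih =>
    exact cons f (ih (hA.mono fun g hg => List.mem_cons_of_mem f hg))
  | @swap f g A =>
    by_cases hfg : g = f
    · subst hfg; exact refl _
    · exact swap A (hA (by simp) (by simp) hfg)
  | trans h₁ _ ih₁ ih₂ =>
    refine trans (ih₁ hA) (ih₂ (hA.mono fun g hg => ?_))
    exact h₁.mem_iff.2 hg

end TraceEq

/-- Trace equivalence as a setoid on words. -/
def traceSetoid (adj : F → F → Prop) (hs : ∀ f g, adj f g → adj g f) : Setoid (List F) where
  r := TraceEq adj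
  iseqv := ⟨.refl, .symm hs, .trans⟩

/-- A word is feasible from the set `U` if it can be addressed letter by letter when `U` is the
set of present flaws and addressing `f` removes `f` and brings in all of `Γ(f)`. By causality, all
flaw sequences of walks starting at `σ` are feasible from `F_σ`. -/
def Feasible (adj : F → F → Prop) : Set F → List F → Prop
  | _, [] => True
  | U, f :: W => f ∈ U ∧ Feasible adj (U \ {f} ∪ nbr adj f) W

theorem Feasible.mono {U V : Set F} (hUV : U ⊆ V) {W : List F} (h : Feasible adj U W) :
    Feasible adj V W := by
  induction W generalizing U V with
  | nil => trivial
  | cons f W ih =>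
    exact ⟨hUV h.1, ih (Set.union_subset_union_left _ (Set.sdiff_subset_sdiff_left hUV)) h.2⟩

theorem Feasible.congr (hs : ∀ f g, adj f g → adj g f) {U : Set F} {V W : List F}
    (hVW : TraceEq adj V W) (h : Feasible adj U V) : Feasible adj U W := by
  induction hVW generalizing U with
  | refl W => exact h
  | @swap f g W hfg =>
    by_cases heq : f = g
    · subst heq; exact h
    obtain ⟨hf, hg, hW⟩ := h
    have hgU : g ∈ U := by
      rcases hg with hg | hg
      · exact hg.1
      · exact absurd hg hfg
    refine ⟨hgU, .inl ⟨hf, heq⟩, hW.mono ?_⟩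
    rintro x (⟨(⟨hx, hxf⟩ | hx), hxg⟩ | hx)
    · exact .inl ⟨.inl ⟨hx, hxg⟩, hxf⟩
    · exact .inr hx
    · refine .inl ⟨.inr hx, ?_⟩
      rintro rfl
      exact hfg (hs _ _ hx)
  | cons f _ ih => exact ⟨h.1, ih h.2⟩
  | trans _ _ ih₁ ih₂ => exact ih₂ (ih₁ h)

/-- If a word needs a flaw of `U` outside `V`, then such a flaw can be moved to its front. -/
theorem Feasible.exists_front {U V : Set F} {W : List F}
    (h : Feasible adj (U ∪ V) W) :
    Feasible adj V W ∨ ∃ f ∈ U, f ∉ V ∧ ∃ W', TraceEq adj W (f :: W') := by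
  induction W generalizing U V with
  | nil => exact .inl trivial
  | cons f W ih =>
    by_cases hfV : f ∈ V
    · have h' : Feasible adj (U \ {f} ∪ (V \ {f} ∪ nbr adj f)) W := by
        refine h.2.mono ?_
        rw [Set.union_sdiff_distrib, Set.union_assoc]
      rcases ih h' with h' | ⟨y, hyU, hyV, W', hW'⟩
      · exact .inl ⟨hfV, h'⟩
      · have hfy : ¬ adj f y := fun hfy => hyV (.inr hfy)
        have hy : y ∉ V := fun hy => hyV (.inl ⟨hy, hyU.2⟩)
        exact .inr ⟨y, hyU.1, hy, f :: W', (hW'.cons f).trans (.swap W' hfy)⟩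
    · exact .inr ⟨f, h.1.resolve_right hfV, hfV, W, .refl _⟩

end Traces

/-! ### Layered words -/

section Layers

variable {F : Type*} [Fintype F] {adj : F → F → Prop}

/-- The set `Γ(I)` of all neighbours of members of `I`. In contrast to `nbrPlus`, it contains
`I` itself only as far as members of `I` have neighbours in `I`. -/
def nbrs (adj : F → F → Prop) (I : Set F) : Set F := {g | ∃ f ∈ I, adj f g}

theorem mem_indSets {U : Set F} {I : Finset F} :
    I ∈ indSets adj U ↔ (I : Set F) ⊆ U ∧ Indep adj (I : Set F) := by
  simp [indSets]

theorem empty_mem_indSets (U : Set F) : ∅ ∈ indSets adj U := by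
  simp [mem_indSets, Indep]

/-- A layered word: a sequence `I₁, I₂, …` of non-empty independent sets of flaws with
`I₁` in the given family and `Iₖ₊₁ ⊆ Γ(Iₖ)`. -/
def Layered (adj : F → F → Prop) : Finset (Finset F) → List (Finset F) → Prop
  | _, [] => True
  | 𝓘, I :: L => I ∈ 𝓘 ∧ I.Nonempty ∧ Layered adj (indSets adj (nbrs adj I)) L

/-- The number of letters of a layered word. -/
def size (L : List (Finset F)) : ℕ := (L.map Finset.card).sum

/-- The word spelled out by a layered word, where `e` lists the members of each layer. -/
def spell (e : Finset F → List F) (L : List (Finset F)) : List F := (L.map e).flatten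

/-- The product of the weights of the letters of a layered word. -/
def layerWeight (ℓ : F → ℝ≥0∞) (L : List (Finset F)) : ℝ≥0∞ :=
  (L.map fun I => ∏ f ∈ I, ℓ f).prod

theorem Layered.mono {𝓘 𝓙 : Finset (Finset F)} (h : 𝓘 ⊆ 𝓙) {L : List (Finset F)}
    (hL : Layered adj 𝓘 L) : Layered adj 𝓙 L := by
  cases L with
  | nil => trivial
  | cons I L => exact ⟨h hL.1, hL.2⟩

omit [Fintype F] in
theorem length_spell {e : Finset F → List F} (he : ∀ I, (e I).Perm I.toList)
    (L : List (Finset F)) : (spell e L).length = size L := by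
  induction L with
  | nil => rfl
  | cons I L ih =>
    simp only [spell, size, List.map_cons, List.flatten_cons, List.length_append, List.sum_cons]
      at ih ⊢
    rw [ih, (he I).length_eq, Finset.length_toList]

omit [Fintype F] in
theorem prod_spell {e : Finset F → List F} (he : ∀ I, (e I).Perm I.toList) (ℓ : F → ℝ≥0∞)
    (L : List (Finset F)) : ((spell e L).map ℓ).prod = layerWeight ℓ L := by
  induction L with
  | nil => rfl
  | cons I L ih =>
    simp only [spell, layerWeight, List.map_cons, List.flatten_cons, List.map_append,
      List.prod_append, List.prod_cons] at ih ⊢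
    rw [ih, ((he I).map ℓ).prod_eq, Finset.prod_map_toList]

/-- Auxiliary form of `Feasible.exists_layered`: the word `A` lists a part of the first layer,
to which letters are added as long as possible. -/
theorem exists_layered_aux (hs : ∀ f g, adj f g → adj g f) {e : Finset F → List F}
    (he : ∀ I, (e I).Perm I.toList) (n : ℕ) :
    ∀ (U : Set F) (A W : List F), W.length = n → A ≠ [] → A.Nodup → {f | f ∈ A} ⊆ U →
      Indep adj {f | f ∈ A} → Feasible adj (U \ {f | f ∈ A} ∪ nbrs adj {f | f ∈ A}) W →
      ∃ L, Layered adj (indSets adj U) L ∧ TraceEq adj (A ++ W) (spell e L) := by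
  classical
  induction n using Nat.strong_induction_on with
  | _ n ih =>
  intro U A W hn hne hnd hAU hA hW
  have hcoe : ((A.toFinset : Finset F) : Set F) = {f | f ∈ A} := by ext; simp
  rcases hW.exists_front with hW | ⟨y, hy, hyA, W', hW'⟩
  · have key : ∃ L, Layered adj (indSets adj (nbrs adj {f | f ∈ A})) L ∧
        TraceEq adj W (spell e L) := by
      cases W with
      | nil => exact ⟨[], trivial, .refl _⟩
      | cons f W =>
        refine ih W.length (by simp at hn; omega) _ [f] W rfl (by simp) (by simp) ?_ ?_
          (hW.2.mono ?_)
        · simpa using hW.1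
        · simp [Indep]
        · rintro x (hx | hx)
          · exact .inl (by simpa using hx)
          · exact .inr ⟨f, by simp, hx⟩
    obtain ⟨L, hL, hWL⟩ := key
    refine ⟨A.toFinset :: L, ⟨mem_indSets.2 (by rw [hcoe]; exact ⟨hAU, hA⟩), ?_, ?_⟩, ?_⟩
    · obtain ⟨f, hf⟩ := List.exists_mem_of_ne_nil A hne
      exact ⟨f, by simpa using hf⟩
    · rwa [hcoe]
    · have hperm : A.Perm (e A.toFinset) :=
        ((List.toFinset_toList hnd).symm).trans (he _).symm
      exact ((TraceEq.of_perm hperm hA).append_right W).trans (hWL.append_left _)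
  · have hset : {f | f ∈ A ++ [y]} = insert y {f | f ∈ A} := by
      ext x; simp [or_comm]
    have hlen := hW'.perm.length_eq
    obtain ⟨L, hL, h⟩ := ih W'.length (by simp at hlen; omega) U (A ++ [y]) W' rfl (by simp)
      (by
        rw [List.nodup_append]
        refine ⟨hnd, by simp, ?_⟩
        rintro a ha b hb rfl
        simp only [List.mem_singleton] at hb
        subst hb
        exact hy.2 ha)
      (by rw [hset]; exact Set.insert_subset hy.1 hAU)
      (by
        rw [hset]
        refine hA.insert fun b hb _ => ⟨fun h => hyA ⟨b, hb, hs _ _ h⟩, fun h => hyA ⟨b, hb, h⟩⟩)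
      (by
        refine ((hW.congr hs hW').2).mono ?_
        rw [hset]
        rintro x (⟨⟨hxU, hxA⟩ | ⟨b, hb, hbx⟩, hxy⟩ | hx)
        · refine .inl ⟨hxU, ?_⟩
          rintro (h | h)
          · exact hxy h
          · exact hxA h
        · exact .inr ⟨b, .inr hb, hbx⟩
        · exact .inr ⟨y, .inl rfl, hx⟩)
    refine ⟨L, hL, (hW'.append_left A).trans ?_⟩
    simpa using h

/-- Every feasible word is trace equivalent to one spelled out by layers (a form of the Foata
normal form). -/
theorem Feasible.exists_layered (hs : ∀ f g, adj f g → adj g f) {e : Finset F → List F}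
    (he : ∀ I, (e I).Perm I.toList) {U : Set F} {W : List F} (hW : Feasible adj U W) :
    ∃ L, Layered adj (indSets adj U) L ∧ TraceEq adj W (spell e L) := by
  cases W with
  | nil => exact ⟨[], trivial, .refl _⟩
  | cons f W =>
    refine exists_layered_aux hs he W.length U [f] W rfl (by simp) (by simp) ?_ ?_ (hW.2.mono ?_)
    · simpa using hW.1
    · simp [Indep]
    · rintro x (hx | hx)
      · exact .inl (by simpa using hx)
      · exact .inr ⟨f, by simp, hx⟩

/-- The total weight of the layered words with `n` letters: if `μ` is non-negative with
`μ(∅) ≥ 1` and `λ^I ∑_{J ∈ Ind(Γ(I))} μ(J) ≤ θ^|I| μ(I)` for independent `I`, then it is at most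
`θ^n ∑_{R} μ(R)` where `R` runs over the possible first layers. -/
theorem tsum_layerWeight_le {ℓ : F → ℝ≥0∞} {μ : Finset F → ℝ≥0∞} {θ : ℝ≥0∞} (h0 : 1 ≤ μ ∅)
    (hμ : ∀ I ∈ indSets adj Set.univ,
      (∏ f ∈ I, ℓ f) * ∑ J ∈ indSets adj (nbrs adj I), μ J ≤ θ ^ I.card * μ I)
    (n : ℕ) (𝓘 : Finset (Finset F)) (h𝓘 : 𝓘 ⊆ indSets adj Set.univ) (h𝓘0 : ∅ ∈ 𝓘) :
    ∑' L : {L // Layered adj 𝓘 L ∧ size L = n}, layerWeight ℓ L.1 ≤ θ ^ n * ∑ R ∈ 𝓘, μ R := by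
  classical
  induction n using Nat.strong_induction_on generalizing 𝓘 with
  | _ n ih =>
  rcases Nat.eq_zero_or_pos n with rfl | hn
  · have huniq : ∀ L : {L // Layered adj 𝓘 L ∧ size L = 0}, L = ⟨[], trivial, rfl⟩ := by
      rintro ⟨_ | ⟨I, L⟩, hL, hsz⟩
      · rfl
      · have := hL.2.1.card_pos
        simp [size] at hsz
        simp [hsz.1] at this
    rw [tsum_eq_single ⟨[], trivial, rfl⟩ fun L hL => absurd (huniq L) hL]
    calc layerWeight ℓ [] = 1 := rfl
      _ ≤ μ ∅ := h0
      _ ≤ ∑ R ∈ 𝓘, μ R := Finset.single_le_sum (f := μ) (fun _ _ => zero_le) h𝓘0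
      _ = θ ^ 0 * ∑ R ∈ 𝓘, μ R := by simp
  · -- Split off the first layer `I`.
    let X := Σ I : {I // I ∈ 𝓘 ∧ I.Nonempty ∧ I.card ≤ n},
      {L // Layered adj (indSets adj (nbrs adj I.1)) L ∧ size L = n - I.1.card}
    let φ : X → {L // Layered adj 𝓘 L ∧ size L = n} := fun x =>
      ⟨x.1.1 :: x.2.1, ⟨x.1.2.1, x.1.2.2.1, x.2.2.1⟩, by
        have h₁ := x.2.2.2
        have h₂ := x.1.2.2.2
        simp only [size, List.map_cons, List.sum_cons] at h₁ ⊢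
        omega⟩
    have hφ : Function.Surjective φ := by
      rintro ⟨_ | ⟨I, L⟩, hL, hsz⟩
      · simp [size] at hsz
        omega
      · simp only [size, List.map_cons, List.sum_cons] at hsz
        exact ⟨⟨⟨I, hL.1, hL.2.1, by omega⟩, ⟨L, hL.2.2, by simp only [size]; omega⟩⟩, rfl⟩
    calc ∑' L : {L // Layered adj 𝓘 L ∧ size L = n}, layerWeight ℓ L.1
        ≤ ∑' x, layerWeight ℓ (φ x).1 := ENNReal.tsum_le_tsum_comp_of_surjective hφ _
      _ = ∑' I : {I // I ∈ 𝓘 ∧ I.Nonempty ∧ I.card ≤ n}, (∏ f ∈ I.1, ℓ f) *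
            ∑' L : {L // Layered adj (indSets adj (nbrs adj I.1)) L ∧ size L = n - I.1.card},
              layerWeight ℓ L.1 := by
          rw [ENNReal.tsum_sigma']
          refine tsum_congr fun I => ?_
          rw [← ENNReal.tsum_mul_left]
          exact tsum_congr fun L => by simp [φ, layerWeight]
      _ ≤ ∑' I : {I // I ∈ 𝓘 ∧ I.Nonempty ∧ I.card ≤ n}, θ ^ n * μ I.1 := by
          refine ENNReal.tsum_le_tsum ?_
          rintro ⟨I, hI, hIne, hIn⟩
          have hpos := hIne.card_pos
          have hsub : indSets adj (nbrs adj I) ⊆ indSets adj Set.univ := fun J hJ =>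
            mem_indSets.2 ⟨Set.subset_univ _, (mem_indSets.1 hJ).2⟩
          calc _ ≤ (∏ f ∈ I, ℓ f) *
                (θ ^ (n - I.card) * ∑ J ∈ indSets adj (nbrs adj I), μ J) := by
                gcongr
                exact ih (n - I.card) (by omega) _ hsub (empty_mem_indSets _)
            _ = θ ^ (n - I.card) *
                ((∏ f ∈ I, ℓ f) * ∑ J ∈ indSets adj (nbrs adj I), μ J) := by ring
            _ ≤ θ ^ (n - I.card) * (θ ^ I.card * μ I) := by
                exact mul_le_mul_right (hμ I (h𝓘 hI)) _
            _ = θ ^ n * μ I := by rw [← mul_assoc, ← pow_add, Nat.sub_add_cancel hIn]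
      _ ≤ ∑' I : {I // I ∈ 𝓘}, θ ^ n * μ I.1 :=
          ENNReal.tsum_comp_le_tsum_of_injective
            (f := fun I : {I // I ∈ 𝓘 ∧ I.Nonempty ∧ I.card ≤ n} => (⟨I.1, I.2.1⟩ : {I // I ∈ 𝓘}))
            (fun I J h => by simpa [Subtype.ext_iff] using h) _
      _ = θ ^ n * ∑ R ∈ 𝓘, μ R := by
          rw [ENNReal.tsum_mul_left, Finset.tsum_subtype]

end Layers

/-! ### The local lemma conditions -/

section Conditions

variable {Ω F : Type*}

/-- A flaw is a non-empty set of objects, so it has a resampling step of positive charge. -/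
theorem FlawCharges.pos {S : Oracles Ω F} {ω : PMF Ω} (hω : ∀ σ, 0 < ω σ) {lam : F → ℝ}
    (h : FlawCharges S ω lam) (f : F) : 0 < lam f := by
  obtain ⟨σ, hσ⟩ := S.flaw_nonempty f
  obtain ⟨σ', hσ'⟩ := (S.rho f σ).support_nonempty
  have hstep : S.Step f σ σ' := ⟨hσ, hσ'⟩
  have h₁ := (ENNReal.le_tsum (f := fun σ : {σ // S.Step f σ σ'} =>
    S.rho f σ σ' * (ω σ / ω σ')) ⟨σ, hstep⟩).trans (h f σ')
  have h₂ : S.rho f σ σ' * (ω σ / ω σ') ≠ 0 :=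
    mul_ne_zero ((PMF.mem_support_iff _ _).1 hσ')
      (ENNReal.div_pos (hω σ).ne' (ω.apply_ne_top σ')).ne'
  exact ENNReal.ofReal_pos.1 ((pos_iff_ne_zero.2 h₂).trans_le h₁)

variable [Fintype F] {adj : F → F → Prop}

theorem indSets_mono {U V : Set F} (h : U ⊆ V) : indSets adj U ⊆ indSets adj V := fun _ hI =>
  mem_indSets.2 ⟨(mem_indSets.1 hI).1.trans h, (mem_indSets.1 hI).2⟩

/-- The sum of `∏ m` over independent sets is submultiplicative under unions. -/
theorem sum_indSets_union_le {m : F → ℝ} (hm : ∀ f, 0 < m f) (U V : Set F) :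
    ∑ J ∈ indSets adj (U ∪ V), ∏ g ∈ J, m g ≤
      (∑ J ∈ indSets adj U, ∏ g ∈ J, m g) * ∑ J ∈ indSets adj V, ∏ g ∈ J, m g := by
  classical
  rw [Finset.sum_mul_sum, ← Finset.sum_product']
  let φ : Finset F → Finset F × Finset F := fun J => (J.filter (· ∈ U), J.filter (· ∉ U))
  have hinj : Function.Injective φ := by
    intro J J' h
    simp only [φ, Prod.mk.injEq] at h
    rw [← Finset.filter_union_filter_not_eq (· ∈ U) J, h.1, h.2,
      Finset.filter_union_filter_not_eq]
  calc ∑ J ∈ indSets adj (U ∪ V), ∏ g ∈ J, m g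
      = ∑ J ∈ indSets adj (U ∪ V), (∏ g ∈ (φ J).1, m g) * ∏ g ∈ (φ J).2, m g :=
        Finset.sum_congr rfl fun J _ => (Finset.prod_filter_mul_prod_filter_not J _ _).symm
    _ = ∑ x ∈ (indSets adj (U ∪ V)).image φ, (∏ g ∈ x.1, m g) * ∏ g ∈ x.2, m g :=
        (Finset.sum_image (f := fun x : Finset F × Finset F => (∏ g ∈ x.1, m g) * ∏ g ∈ x.2, m g)
          fun J _ J' _ h => hinj h).symm
    _ ≤ _ := by
        refine Finset.sum_le_sum_of_subset_of_nonneg ?_ fun x _ _ =>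
          mul_nonneg (Finset.prod_nonneg fun g _ => (hm g).le)
            (Finset.prod_nonneg fun g _ => (hm g).le)
        intro x hx
        obtain ⟨J, hJ, rfl⟩ := Finset.mem_image.1 hx
        obtain ⟨hJ₁, hJ₂⟩ := mem_indSets.1 hJ
        refine Finset.mem_product.2 ⟨mem_indSets.2 ⟨?_, ?_⟩, mem_indSets.2 ⟨?_, ?_⟩⟩
        · intro g hg
          exact (Finset.mem_filter.1 hg).2
        · exact hJ₂.mono fun g hg => (Finset.mem_filter.1 hg).1
        · intro g hg
          exact (hJ₁ (Finset.mem_filter.1 hg).1).resolve_left (Finset.mem_filter.1 hg).2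
        · exact hJ₂.mono fun g hg => (Finset.mem_filter.1 hg).1

theorem ClusterExpansion.layer_le {θ : ℝ} {lam m : F → ℝ} (hlam : ∀ f, 0 < lam f)
    (h : ClusterExpansion adj θ lam m) (I : Finset F) :
    (∏ f ∈ I, lam f) * ∑ J ∈ indSets adj (nbrs adj I), ∏ g ∈ J, m g ≤
      θ ^ I.card * ∏ f ∈ I, m f := by
  classical
  obtain ⟨hm, h⟩ := h
  have hnn : ∀ U : Set F, 0 ≤ ∑ J ∈ indSets adj U, ∏ g ∈ J, m g := fun U =>
    Finset.sum_nonneg fun J _ => Finset.prod_nonneg fun g _ => (hm g).le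
  induction I using Finset.induction_on with
  | empty =>
    have : indSets adj (nbrs adj (∅ : Set F)) = {∅} := by
      ext J
      simp only [mem_indSets, nbrs, Finset.mem_singleton]
      constructor
      · rintro ⟨h, -⟩
        exact Finset.eq_empty_of_forall_notMem fun g hg => by simpa using h hg
      · rintro rfl
        simp [Indep]
    simp [this]
  | insert f I hf ih =>
    have hset : nbrs adj (↑(insert f I) : Set F) = nbr adj f ∪ nbrs adj I := by
      ext g
      simp [nbrs, nbr]
    have hf' : lam f * ∑ J ∈ indSets adj (nbr adj f), ∏ g ∈ J, m g ≤ θ * m f := by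
      have := h f
      rwa [div_mul_eq_mul_div, div_le_iff₀ (hm f)] at this
    rw [Finset.prod_insert hf, Finset.prod_insert hf, Finset.card_insert_of_notMem hf, hset]
    calc lam f * (∏ f ∈ I, lam f) * ∑ J ∈ indSets adj (nbr adj f ∪ nbrs adj I), ∏ g ∈ J, m g
        ≤ lam f * (∏ f ∈ I, lam f) * ((∑ J ∈ indSets adj (nbr adj f), ∏ g ∈ J, m g) *
            ∑ J ∈ indSets adj (nbrs adj I), ∏ g ∈ J, m g) := by
          refine mul_le_mul_of_nonneg_left (sum_indSets_union_le hm _ _) ?_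
          exact mul_nonneg (hlam f).le (Finset.prod_nonneg fun g _ => (hlam g).le)
      _ = (lam f * ∑ J ∈ indSets adj (nbr adj f), ∏ g ∈ J, m g) *
            ((∏ f ∈ I, lam f) * ∑ J ∈ indSets adj (nbrs adj I), ∏ g ∈ J, m g) := by ring
      _ ≤ (θ * m f) * (θ ^ I.card * ∏ f ∈ I, m f) := by
          refine mul_le_mul hf' ih ?_ ?_
          · exact mul_nonneg (Finset.prod_nonneg fun g _ => (hlam g).le) (hnn _)
          · exact (mul_nonneg (hlam f).le (hnn _)).trans hf'
      _ = θ ^ (I.card + 1) * (m f * ∏ f ∈ I, m f) := by ring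

/-- Inclusion–exclusion: `∑_{J ∈ Ind(Y)} q_J` is the alternating sum over the independent sets
that avoid `Y`. -/
theorem sum_shearerQ (p : F → ℝ) (Y : Set F)
    [DecidablePred fun K : Finset F => Disjoint (K : Set F) Y] :
    ∑ J ∈ indSets adj Y, shearerQ adj p J =
      ∑ K ∈ (indSets adj Set.univ).filter (fun K : Finset F => Disjoint (K : Set F) Y),
        (-1) ^ K.card * ∏ f ∈ K, p f := by
  classical
  have h₁ : ∀ K ∈ indSets adj Set.univ,
      (indSets adj Y).filter (fun J => J ⊆ K) = (K.filter (· ∈ Y)).powerset := by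
    intro K hK
    ext J
    simp only [Finset.mem_filter, mem_indSets, Finset.mem_powerset, Finset.subset_iff]
    constructor
    · rintro ⟨⟨h, -⟩, h'⟩ g hg
      exact ⟨h' hg, h hg⟩
    · intro h
      exact ⟨⟨fun g hg => (h hg).2, (mem_indSets.1 hK).2.mono fun g hg => (h hg).1⟩,
        fun g hg => (h hg).1⟩
  have h₂ : ∀ K ∈ indSets adj Set.univ,
      ∑ J ∈ (K.filter (· ∈ Y)).powerset, (-1 : ℝ) ^ (K.card - J.card) * ∏ f ∈ K, p f =
        if Disjoint (K : Set F) Y then (-1) ^ K.card * ∏ f ∈ K, p f else 0 := by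
    intro K _
    rw [← Finset.sum_mul]
    have : ∑ J ∈ (K.filter (· ∈ Y)).powerset, (-1 : ℝ) ^ (K.card - J.card) =
        (-1) ^ K.card * ((∑ J ∈ (K.filter (· ∈ Y)).powerset, (-1 : ℤ) ^ J.card : ℤ) : ℝ) := by
      push_cast
      rw [Finset.mul_sum]
      refine Finset.sum_congr rfl fun J hJ => ?_
      have hle : J.card ≤ K.card := Finset.card_le_card
        ((Finset.mem_powerset.1 hJ).trans (Finset.filter_subset _ _))
      have h : (-1 : ℝ) ^ K.card = (-1) ^ (K.card - J.card) * (-1) ^ J.card := by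
        rw [← pow_add, Nat.sub_add_cancel hle]
      rw [h, mul_assoc, ← mul_pow]
      simp
    rw [this, Finset.sum_powerset_neg_one_pow_card]
    have hiff : K.filter (· ∈ Y) = ∅ ↔ Disjoint (K : Set F) Y := by
      rw [Finset.filter_eq_empty_iff, Set.disjoint_left]
      rfl
    by_cases h : Disjoint (K : Set F) Y
    · simp [h, hiff.2 h]
    · simp [h, hiff]
  rw [Finset.sum_filter, ← Finset.sum_congr rfl h₂]
  simp only [shearerQ]
  rw [Finset.sum_comm' (s' := fun K => (K.filter (· ∈ Y)).powerset) (t' := indSets adj Set.univ)]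
  intro J K
  constructor
  · rintro ⟨hJ, hK⟩
    have hK := Finset.mem_filter.1 hK
    exact ⟨by rw [← h₁ K hK.1]; exact Finset.mem_filter.2 ⟨hJ, hK.2⟩, hK.1⟩
  · rintro ⟨hJ, hK⟩
    rw [← h₁ K hK] at hJ
    have hJ := Finset.mem_filter.1 hJ
    exact ⟨hJ.1, Finset.mem_filter.2 ⟨hK, hJ.2⟩⟩

/-- A superset of `I` in `Ind(F)` is `I` together with an independent set that avoids `Γ⁺(I)`. -/
theorem shearerQ_eq (hs : ∀ f g, adj f g → adj g f) (p : F → ℝ) {I : Finset F}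
    (hI : I ∈ indSets adj Set.univ) :
    shearerQ adj p I =
      (∏ f ∈ I, p f) * ∑ J ∈ indSets adj (nbrPlus adj I), shearerQ adj p J := by
  classical
  rw [sum_shearerQ, shearerQ, Finset.mul_sum]
  refine (Finset.sum_nbij' (fun K => I ∪ K) (fun K => K \ I) ?_ ?_ ?_ ?_ ?_).symm
  · intro K hK
    obtain ⟨hK, hd⟩ := Finset.mem_filter.1 hK
    have hd := Set.disjoint_left.1 hd
    refine Finset.mem_filter.2 ⟨mem_indSets.2 ⟨Set.subset_univ _, ?_⟩, Finset.subset_union_left⟩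
    intro f hf g hg hfg
    rcases Finset.mem_union.1 hf with hf | hf <;> rcases Finset.mem_union.1 hg with hg | hg
    · exact (mem_indSets.1 hI).2 hf hg hfg
    · exact fun h => hd hg ⟨f, hf, .inr h⟩
    · exact fun h => hd hf ⟨g, hg, .inr (hs _ _ h)⟩
    · exact (mem_indSets.1 hK).2 hf hg hfg
  · intro K hK
    obtain ⟨hK, hIK⟩ := Finset.mem_filter.1 hK
    refine Finset.mem_filter.2 ⟨mem_indSets.2 ⟨Set.subset_univ _,
      (mem_indSets.1 hK).2.mono fun f hf => (Finset.mem_sdiff.1 hf).1⟩, ?_⟩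
    refine Set.disjoint_left.2 ?_
    rintro g hg ⟨f, hf, rfl | hfg⟩
    · exact (Finset.mem_sdiff.1 hg).2 hf
    · obtain ⟨hgK, hgI⟩ := Finset.mem_sdiff.1 hg
      refine (mem_indSets.1 hK).2 (hIK hf) hgK ?_ hfg
      rintro rfl
      exact hgI hf
  · intro K hK
    have hd := Set.disjoint_left.1 (Finset.mem_filter.1 hK).2
    refine Finset.union_sdiff_cancel_left (Finset.disjoint_left.2 fun f hf hfK => ?_)
    exact hd hfK ⟨f, hf, .inl rfl⟩
  · intro K hK
    exact Finset.union_sdiff_of_subset (Finset.mem_filter.1 hK).2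
  · intro K hK
    have hd := Set.disjoint_left.1 (Finset.mem_filter.1 hK).2
    have hdis : Disjoint I K := Finset.disjoint_left.2 fun f hf hfK => hd hfK ⟨f, hf, .inl rfl⟩
    rw [Finset.card_union_of_disjoint hdis, Nat.add_sub_cancel_left, Finset.prod_union hdis]
    ring

theorem ShearerVector.layer_le (hs : ∀ f g, adj f g → adj g f) {θ : ℝ} {lam p : F → ℝ}
    (hlam : ∀ f, 0 < lam f) (h : ShearerVector adj p) (hle : ∀ f, lam f ≤ θ * p f)
    {I : Finset F} (hI : I ∈ indSets adj Set.univ) :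
    (∏ f ∈ I, lam f) * ∑ J ∈ indSets adj (nbrs adj I), shearerQ adj p J ≤
      θ ^ I.card * shearerQ adj p I := by
  have hnn : ∀ U : Set F, 0 ≤ ∑ J ∈ indSets adj U, shearerQ adj p J := fun U =>
    Finset.sum_nonneg fun J _ => h.1 J
  have hsub : nbrs adj I ⊆ nbrPlus adj I := fun g ⟨f, hf, hfg⟩ => ⟨f, hf, .inr hfg⟩
  have hprod : ∏ f ∈ I, lam f ≤ ∏ f ∈ I, θ * p f :=
    Finset.prod_le_prod (fun f _ => (hlam f).le) fun f _ => hle f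
  calc (∏ f ∈ I, lam f) * ∑ J ∈ indSets adj (nbrs adj I), shearerQ adj p J
      ≤ (∏ f ∈ I, θ * p f) * ∑ J ∈ indSets adj (nbrPlus adj I), shearerQ adj p J :=
        mul_le_mul hprod
          (Finset.sum_le_sum_of_subset_of_nonneg (indSets_mono hsub) fun J _ _ => h.1 J) (hnn _)
          ((Finset.prod_nonneg fun f _ => (hlam f).le).trans hprod)
    _ = θ ^ I.card * shearerQ adj p I := by
        rw [shearerQ_eq hs p hI, Finset.prod_mul_distrib, Finset.prod_const]
        ring

/-- The common consequence of both conditions: the weights `μ` dominate one layer of resampled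
flaws together with everything that may follow in the next layer. -/
theorem layer_condition {S : Oracles Ω F} (hs : ∀ f g, adj f g → adj g f) {ω : PMF Ω}
    (hω : ∀ σ, 0 < ω σ) {θ : ℝ} {μ : Finset F → ℝ}
    (hcond :
      (∃ lam m : F → ℝ, FlawCharges S ω lam ∧ ClusterExpansion adj θ lam m ∧
        ∀ R, μ R = ∏ f ∈ R, m f) ∨
      (∃ lam p : F → ℝ, FlawCharges S ω lam ∧ ShearerVector adj p ∧
        (∀ f, lam f ≤ θ * p f) ∧
        ∀ R, μ R = shearerQ adj p R / shearerQ adj p ∅)) :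
    (∀ R, 0 ≤ μ R) ∧ μ ∅ = 1 ∧ ∃ lam : F → ℝ, FlawCharges S ω lam ∧
      ∀ I ∈ indSets adj Set.univ,
        (∏ f ∈ I, lam f) * ∑ J ∈ indSets adj (nbrs adj I), μ J ≤ θ ^ I.card * μ I := by
  rcases hcond with ⟨lam, m, hch, hcl, hμ⟩ | ⟨lam, p, hch, hsh, hle, hμ⟩
  · refine ⟨fun R => ?_, by simp [hμ], lam, hch, fun I _ => ?_⟩
    · rw [hμ]
      exact Finset.prod_nonneg fun f _ => (hcl.1 f).le
    · simp only [hμ]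
      exact hcl.layer_le (hch.pos hω) I
  · refine ⟨fun R => ?_, ?_, lam, hch, fun I hI => ?_⟩
    · rw [hμ]
      exact div_nonneg (hsh.1 R) hsh.2.le
    · rw [hμ]
      exact div_self hsh.2.ne'
    · simp only [hμ]
      rw [← Finset.sum_div, ← mul_div_assoc, ← mul_div_assoc]
      exact div_le_div_of_nonneg_right (hsh.layer_le hs (hch.pos hω) hle hI) hsh.2.le

end Conditions

/-! ### The probability of surviving many steps -/

section Survival

variable {Ω F : Type*} {S : Oracles Ω F}

theorem tsum_map_mul {α β : Type*} (p : PMF α) (g : α → β) (u : β → ℝ≥0∞) :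
    ∑' b, p.map g b * u b = ∑' a, p a * u (g a) := by
  classical
  simp_rw [PMF.map_apply, ← ENNReal.tsum_mul_right]
  rw [ENNReal.tsum_comm]
  refine tsum_congr fun a => ?_
  rw [tsum_eq_single (g a) fun b hb => by simp [hb]]
  simp

theorem tsum_bind_mul {α β : Type*} (p : PMF α) (q : α → PMF β) (u : β → ℝ≥0∞) :
    ∑' b, p.bind q b * u b = ∑' a, p a * ∑' b, q a b * u b := by
  simp_rw [PMF.bind_apply, ← ENNReal.tsum_mul_right, ← ENNReal.tsum_mul_left]
  rw [ENNReal.tsum_comm]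
  simp_rw [mul_assoc]

open Classical in
/-- The probability that the execution with history `h` makes at least `n` further steps. -/
def survival (S : Oracles Ω F) (Λ : Strategy S) : ℕ → History Ω F → ℝ≥0∞
  | 0, _ => 1
  | n + 1, h =>
    if hne : ¬ S.Flawless h.last then
      ∑' f, Λ.select h hne f * ∑' σ, S.rho f h.last σ * survival S Λ n (h.step f σ)
    else 0

variable (Λ : Strategy S) (ωinit : PMF Ω)

theorem steps_of_mem_support_run (n : ℕ) (h : History Ω F) (hh : run S Λ ωinit n h ≠ 0) :
    h.steps = n ∨ S.Flawless h.last ∧ h.steps < n := by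
  classical
  induction n generalizing h with
  | zero =>
    rw [← PMF.mem_support_iff] at hh
    simp only [run, PMF.support_map] at hh
    obtain ⟨σ, -, rfl⟩ := hh
    exact .inl rfl
  | succ n ih =>
    rw [← PMF.mem_support_iff] at hh
    simp only [run, PMF.mem_support_bind_iff] at hh
    obtain ⟨h', hh', hh⟩ := hh
    have ih := ih h' hh'
    unfold iteration at hh
    by_cases hne : S.Flawless h'.last
    · rw [dif_neg (not_not.2 hne), PMF.support_pure, Set.mem_singleton_iff] at hh
      subst hh
      rcases ih with ih | ih
      · exact .inr ⟨hne, by omega⟩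
      · exact .inr ⟨ih.1, by omega⟩
    · rw [dif_pos hne] at hh
      simp only [PMF.mem_support_bind_iff, PMF.support_map] at hh
      obtain ⟨f, -, σ, -, rfl⟩ := hh
      have := ih.resolve_right fun h => hne h.1
      exact .inl (by simp [History.steps, this])

open Classical in
/-- Splitting `m + k` steps into the first `m` and the remaining `k`. -/
theorem tsum_run_mul_survival (m k : ℕ) :
    ∑' h, run S Λ ωinit m h * (if h.steps = m then survival S Λ k h else 0) =
      ∑' σ, ωinit σ * survival S Λ (m + k) (.start σ) := by
  induction m generalizing k with
  | zero =>
    rw [run, tsum_map_mul]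
    simp [History.steps]
  | succ m ih =>
    rw [run, tsum_bind_mul, Nat.add_right_comm, Nat.add_assoc, ← ih (k + 1)]
    refine tsum_congr fun h => ?_
    by_cases hh : run S Λ ωinit m h = 0
    · simp [hh]
    congr 1
    have hsteps := steps_of_mem_support_run Λ ωinit m h hh
    by_cases hne : S.Flawless h.last
    · have hit : iteration S Λ h = PMF.pure h := by simp [iteration, hne]
      rw [hit, tsum_eq_single h fun b hb => by simp [hb]]
      have h₁ : h.steps ≠ m + 1 := by omega
      simp [h₁, survival, hne]
    · have hm : h.steps = m := hsteps.resolve_right fun h => hne h.1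
      rw [iteration, dif_pos hne, tsum_bind_mul, if_pos hm, survival, dif_pos hne]
      refine tsum_congr fun f => ?_
      rw [tsum_map_mul]
      simp [History.steps, hm]

/-- An execution that does not make `⌈x⌉₊` steps terminates in fewer than `x` steps. -/
theorem one_le_probFewerSteps_add (x : ℝ) :
    1 ≤ probFewerSteps S Λ ωinit x +
      ∑' σ, ωinit σ * survival S Λ ⌈x⌉₊ (.start σ) := by
  classical
  set n := ⌈x⌉₊ with hn
  have h₁ : (run S Λ ωinit n).toOuterMeasure {h | S.Flawless h.last ∧ (h.steps : ℝ) < x} ≤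
      probFewerSteps S Λ ωinit x :=
    le_iSup (fun n => (run S Λ ωinit n).toOuterMeasure
      {h | S.Flawless h.last ∧ (h.steps : ℝ) < x}) n
  have h₂ := tsum_run_mul_survival Λ ωinit n 0
  rw [Nat.add_zero] at h₂
  rw [← h₂, ← (run S Λ ωinit n).tsum_coe]
  refine le_trans ?_ (add_le_add_left h₁ _)
  rw [PMF.toOuterMeasure_apply, ← ENNReal.tsum_add]
  refine ENNReal.tsum_le_tsum fun h => ?_
  by_cases hh : run S Λ ωinit n h = 0
  · simp [hh]
  rcases steps_of_mem_support_run Λ ωinit n h hh with hs | ⟨hs, hlt⟩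
  · simp [hs, survival]
  · have hmem : h ∈ {h : History Ω F | S.Flawless h.last ∧ (h.steps : ℝ) < x} :=
      ⟨hs, Nat.lt_ceil.1 hlt⟩
    rw [Set.indicator_of_mem hmem]
    exact le_self_add

end Survival

/-! ### Bounding survival by a sum over flaw sequences -/

section Codes

variable {Ω F : Type*} {S : Oracles Ω F}

/-- A charge kernel majorizes the resampling probabilities reweighted by `ω`, in such a way that
its column sums are bounded by `ℓ`. -/
structure IsChargeKernel (S : Oracles Ω F) (ω : PMF Ω) (ℓ : F → ℝ≥0∞)
    (K : F → Ω → Ω → ℝ≥0∞) : Prop where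
  step_of_ne_zero : ∀ {f σ σ'}, K f σ σ' ≠ 0 → S.Step f σ σ'
  le : ∀ {f σ σ'}, S.Step f σ σ' → ω σ * S.rho f σ σ' ≤ K f σ σ' * ω σ'
  tsum_le : ∀ f σ', ∑' σ, K f σ σ' ≤ ℓ f

/-- The total charge of the walks from a given object whose sequence of flaws is the given
word. -/
def wordCharge (ω : PMF Ω) (K : F → Ω → Ω → ℝ≥0∞) : List F → Ω → ℝ≥0∞
  | [], σ => ω σ
  | f :: W, σ => ∑' σ', K f σ σ' * wordCharge ω K W σ'

variable {ω : PMF Ω} {ℓ : F → ℝ≥0∞} {K : F → Ω → Ω → ℝ≥0∞}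

/-- Summing over the initial object first, each letter costs one column sum of `K`. -/
theorem IsChargeKernel.tsum_wordCharge_le (hK : IsChargeKernel S ω ℓ K) (W : List F) :
    ∑' σ, wordCharge ω K W σ ≤ (W.map ℓ).prod := by
  induction W with
  | nil => simp [wordCharge]
  | cons f W ih =>
    simp only [wordCharge, List.map_cons, List.prod_cons]
    rw [ENNReal.tsum_comm]
    simp_rw [ENNReal.tsum_mul_right]
    calc ∑' σ', (∑' σ, K f σ σ') * wordCharge ω K W σ'
        ≤ ∑' σ', ℓ f * wordCharge ω K W σ' :=
          ENNReal.tsum_le_tsum fun σ' => mul_le_mul_left (hK.tsum_le f σ') _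
      _ = ℓ f * ∑' σ', wordCharge ω K W σ' := ENNReal.tsum_mul_left
      _ ≤ _ := mul_le_mul_right ih _

theorem IsChargeKernel.feasible (hK : IsChargeKernel S ω ℓ K) {adj : F → F → Prop}
    (hadj : IsPotentialCausalityGraph S adj) {W : List F} {σ : Ω}
    (h : wordCharge ω K W σ ≠ 0) : Feasible adj (S.present σ) W := by
  induction W generalizing σ with
  | nil => trivial
  | cons f W ih =>
    simp only [wordCharge, ne_eq, ENNReal.tsum_eq_zero, not_forall, mul_eq_zero, not_or] at h
    obtain ⟨σ', h₁, h₂⟩ := h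
    have hstep := hK.step_of_ne_zero h₁
    exact ⟨hstep.1, (ih h₂).mono (hadj.causality f σ σ' hstep)⟩

/-- If the kernels of non-adjacent flaws commute, the charge is a function of the trace. -/
theorem wordCharge_congr {adj : F → F → Prop}
    (hcomm : ∀ f g, ¬ adj f g → ∀ σ₁ σ₃,
      ∑' σ₂, K f σ₁ σ₂ * K g σ₂ σ₃ = ∑' σ₂, K g σ₁ σ₂ * K f σ₂ σ₃)
    {V W : List F} (h : TraceEq adj V W) (σ : Ω) : wordCharge ω K V σ = wordCharge ω K W σ := by
  have two : ∀ f g W σ, wordCharge ω K (f :: g :: W) σ =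
      ∑' σ₃, (∑' σ₂, K f σ σ₂ * K g σ₂ σ₃) * wordCharge ω K W σ₃ := by
    intro f g W σ
    simp only [wordCharge, ← ENNReal.tsum_mul_left, ← ENNReal.tsum_mul_right]
    rw [ENNReal.tsum_comm]
    simp_rw [mul_assoc]
  induction h generalizing σ with
  | refl W => rfl
  | swap W hfg => simp_rw [two, hcomm _ _ hfg]
  | cons f _ ih => simp only [wordCharge, ih]
  | trans _ _ ih₁ ih₂ => rw [ih₁, ih₂]

/-- Flaw sequences are recorded by codes in `X` (words, or words up to commutation) to which a
letter can be prepended injectively. If `C n h` contains the codes of all possible continuations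
of `h` by `n` steps, then survival is bounded by the total charge of `C n h`. Injectivity of
`cons f` for each single `f` suffices because the flaw selected next is determined, up to the
randomness in `Λ`, by the history alone. -/
theorem survival_le {X : Type*} (hK : IsChargeKernel S ω ℓ K) (Λ : Strategy S)
    (v : X → Ω → ℝ≥0∞) (cons : F → X → X) (hcons : ∀ f, Function.Injective (cons f))
    (hv : ∀ f x σ, v (cons f x) σ = ∑' σ', K f σ σ' * v x σ')
    (C : ℕ → History Ω F → Set X)
    (hC0 : ∀ h, ∃ x ∈ C 0 h, v x = ω)
    (hC : ∀ n h hne f σ', f ∈ (Λ.select h hne).support → S.Step f h.last σ' →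
      ∀ x ∈ C n (h.step f σ'), cons f x ∈ C (n + 1) h)
    (n : ℕ) (h : History Ω F) :
    ω h.last * survival S Λ n h ≤ ∑' x : C n h, v x h.last := by
  classical
  induction n generalizing h with
  | zero =>
    obtain ⟨x, hx, hvx⟩ := hC0 h
    rw [survival, mul_one, ← hvx]
    exact ENNReal.le_tsum (f := fun x : C 0 h => v x h.last) ⟨x, hx⟩
  | succ n ih =>
    rw [survival]
    by_cases hne : S.Flawless h.last
    · simp [hne]
    rw [dif_pos hne]
    set T := ∑' x : C (n + 1) h, v x h.last with hT
    have key : ∀ f ∈ (Λ.select h hne).support,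
        ω h.last * ∑' σ', S.rho f h.last σ' * survival S Λ n (h.step f σ') ≤ T := by
      intro f hf
      let D : Set X := {x | cons f x ∈ C (n + 1) h}
      calc ω h.last * ∑' σ', S.rho f h.last σ' * survival S Λ n (h.step f σ')
          = ∑' σ', ω h.last * S.rho f h.last σ' * survival S Λ n (h.step f σ') := by
            rw [← ENNReal.tsum_mul_left]
            simp_rw [mul_assoc]
        _ ≤ ∑' σ', K f h.last σ' * ∑' x : D, v x σ' := by
            refine ENNReal.tsum_le_tsum fun σ' => ?_
            by_cases hstep : S.Step f h.last σ'
            · calc ω h.last * S.rho f h.last σ' * survival S Λ n (h.step f σ')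
                  ≤ K f h.last σ' * ω σ' * survival S Λ n (h.step f σ') :=
                    mul_le_mul_left (hK.le hstep) _
                _ = K f h.last σ' * (ω σ' * survival S Λ n (h.step f σ')) := mul_assoc _ _ _
                _ ≤ K f h.last σ' * ∑' x : C n (h.step f σ'), v x σ' :=
                    mul_le_mul_right (ih (h.step f σ')) _
                _ ≤ K f h.last σ' * ∑' x : D, v x σ' := by
                    have hD : C n (h.step f σ') ⊆ D := fun x hx =>
                      hC n h hne f σ' hf hstep x hx
                    exact mul_le_mul_right
                      (ENNReal.tsum_mono_subtype (fun x => v x σ') hD) _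
            · have h0 : S.rho f h.last σ' = 0 := by
                by_contra h0
                exact hstep ⟨Λ.select_present h hne hf, (PMF.mem_support_iff _ _).2 h0⟩
              simp [h0]
        _ = ∑' x : D, v (cons f x) h.last := by
            simp_rw [← ENNReal.tsum_mul_left]
            rw [ENNReal.tsum_comm]
            simp_rw [hv]
        _ ≤ T := ENNReal.tsum_comp_le_tsum_of_injective
            (f := fun x : D => (⟨cons f x.1, x.2⟩ : C (n + 1) h))
            (fun x y hxy => Subtype.ext (hcons f (congrArg Subtype.val hxy)))
            fun x => v x.1 h.last
    calc ω h.last * ∑' f, Λ.select h hne f *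
          ∑' σ', S.rho f h.last σ' * survival S Λ n (h.step f σ')
        = ∑' f, Λ.select h hne f *
          (ω h.last * ∑' σ', S.rho f h.last σ' * survival S Λ n (h.step f σ')) := by
          rw [← ENNReal.tsum_mul_left]
          exact tsum_congr fun f => mul_left_comm _ _ _
      _ ≤ ∑' f, Λ.select h hne f * T := by
          refine ENNReal.tsum_le_tsum fun f => ?_
          by_cases hf : f ∈ (Λ.select h hne).support
          · exact mul_le_mul_right (key f hf) _
          · rw [PMF.mem_support_iff, not_not] at hf
            simp [hf]
      _ = T := by rw [ENNReal.tsum_mul_right, PMF.tsum_coe, one_mul]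

/-- Averaging `survival_le` over the initial object, when every code that occurs is represented
by a layered word. -/
theorem tsum_survival_le {X : Type*} [Fintype F] {adj : F → F → Prop}
    (hK : IsChargeKernel S ω ℓ K) (Λ : Strategy S) (hω : ∀ σ, 0 < ω σ) (ωinit : PMF Ω)
    (v : X → Ω → ℝ≥0∞) (cons : F → X → X) (hcons : ∀ f, Function.Injective (cons f))
    (hv : ∀ f x σ, v (cons f x) σ = ∑' σ', K f σ σ' * v x σ')
    (C : ℕ → History Ω F → Set X)
    (hC0 : ∀ h, ∃ x ∈ C 0 h, v x = ω)
    (hC : ∀ n h hne f σ', f ∈ (Λ.select h hne).support → S.Step f h.last σ' →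
      ∀ x ∈ C n (h.step f σ'), cons f x ∈ C (n + 1) h)
    (n : ℕ) (φ : List (Finset F) → X)
    (hφ : ∀ L, ∑' σ, v (φ L) σ ≤ layerWeight ℓ L)
    (hrep : ∀ σ ∈ ωinit.support, ∀ x ∈ C n (.start σ), v x σ ≠ 0 →
      ∃ L, (Layered adj (indInit S adj ωinit) L ∧ size L = n) ∧ φ L = x) :
    ∑' σ, ωinit σ * survival S Λ n (.start σ) ≤ gammaInit ω ωinit *
      ∑' L : {L // Layered adj (indInit S adj ωinit) L ∧ size L = n}, layerWeight ℓ L.1 := by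
  classical
  -- Summing over codes before objects requires a set of codes that does not depend on `σ`.
  let Y : Set X := {x | ∃ L, (Layered adj (indInit S adj ωinit) L ∧ size L = n) ∧ φ L = x}
  have h₁ : ∀ σ, ωinit σ * survival S Λ n (.start σ) ≤
      gammaInit ω ωinit * ∑' x : Y, v x σ := by
    intro σ
    by_cases hσ : σ ∈ ωinit.support
    · have hγ : ωinit σ ≤ gammaInit ω ωinit * ω σ :=
        (ENNReal.div_le_iff (hω σ).ne' (ω.apply_ne_top σ)).1
          (le_iSup (fun σ => ωinit σ / ω σ) σ)
      calc ωinit σ * survival S Λ n (.start σ)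
          ≤ gammaInit ω ωinit * ω σ * survival S Λ n (.start σ) := mul_le_mul_left hγ _
        _ = gammaInit ω ωinit * (ω σ * survival S Λ n (.start σ)) := mul_assoc _ _ _
        _ ≤ gammaInit ω ωinit * ∑' x : C n (.start σ), v x σ :=
            mul_le_mul_right
              (survival_le hK Λ v cons hcons hv C hC0 hC n (.start σ)) _
        _ ≤ gammaInit ω ωinit * ∑' x : Y, v x σ := by
            refine mul_le_mul_right ?_ _
            rw [tsum_subtype (C n (.start σ)) fun x => v x σ, tsum_subtype Y fun x => v x σ]
            refine ENNReal.tsum_le_tsum fun x => ?_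
            by_cases hx : x ∈ C n (.start σ)
            · by_cases hvx : v x σ = 0
              · simp [Set.indicator, hvx]
              · have hxY : x ∈ Y := hrep σ hσ x hx hvx
                rw [Set.indicator_of_mem hx, Set.indicator_of_mem hxY]
            · simp [Set.indicator_of_notMem hx]
    · rw [PMF.mem_support_iff, not_not] at hσ
      simp [hσ]
  calc ∑' σ, ωinit σ * survival S Λ n (.start σ)
      ≤ ∑' σ, gammaInit ω ωinit * ∑' x : Y, v x σ := ENNReal.tsum_le_tsum h₁
    _ = gammaInit ω ωinit * ∑' x : Y, ∑' σ, v x σ := by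
        rw [ENNReal.tsum_mul_left, ENNReal.tsum_comm]
    _ ≤ gammaInit ω ωinit *
        ∑' L : {L // Layered adj (indInit S adj ωinit) L ∧ size L = n}, ∑' σ, v (φ L.1) σ := by
        refine mul_le_mul_right ?_ _
        exact ENNReal.tsum_le_tsum_comp_of_surjective
          (f := fun L : {L // Layered adj (indInit S adj ωinit) L ∧ size L = n} =>
            (⟨φ L.1, L.1, L.2, rfl⟩ : Y))
          (fun ⟨x, L, hL, hx⟩ => ⟨⟨L, hL⟩, Subtype.ext hx⟩) fun x => ∑' σ, v x.1 σ
    _ ≤ _ := mul_le_mul_right (ENNReal.tsum_le_tsum fun L => hφ _) _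

end Codes

/-! ### Charge kernels -/

section Kernels

variable {Ω F : Type*} {S : Oracles Ω F} {ω : PMF Ω} {lam : F → ℝ} {adj : F → F → Prop}

open Classical in
/-- The resampling probabilities, reweighted by `ω`. -/
def ratioKernel (S : Oracles Ω F) (ω : PMF Ω) (f : F) (σ σ' : Ω) : ℝ≥0∞ :=
  if S.Step f σ σ' then S.rho f σ σ' * (ω σ / ω σ') else 0

open Classical in
/-- The kernel that charges `λ_f` for every possible resampling step. -/
def constKernel (S : Oracles Ω F) (lam : F → ℝ) (f : F) (σ σ' : Ω) : ℝ≥0∞ :=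
  if S.Step f σ σ' then ENNReal.ofReal (lam f) else 0

theorem weight_eq (hω : ∀ σ, 0 < ω σ) (a : ℝ≥0∞) (σ σ' : Ω) :
    ω σ * a = a * (ω σ / ω σ') * ω σ' := by
  rw [mul_assoc, ENNReal.div_mul_cancel (hω σ').ne' (ω.apply_ne_top σ'), mul_comm]

theorem isChargeKernel_ratioKernel (hω : ∀ σ, 0 < ω σ) (h : FlawCharges S ω lam) :
    IsChargeKernel S ω (fun f => ENNReal.ofReal (lam f)) (ratioKernel S ω) where
  step_of_ne_zero {f σ σ'} hne := by
    by_contra hstep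
    exact hne (if_neg hstep)
  le {f σ σ'} hstep := by
    rw [ratioKernel, if_pos hstep]
    exact (weight_eq hω _ _ _).le
  tsum_le f σ' := by
    refine le_trans (le_of_eq ?_) (h f σ')
    exact (tsum_subtype {σ | S.Step f σ σ'} fun σ => S.rho f σ σ' * (ω σ / ω σ')).symm

theorem isChargeKernel_constKernel (hω : ∀ σ, 0 < ω σ) (h : FlawCharges S ω lam)
    (hat : S.Atomic) :
    IsChargeKernel S ω (fun f => ENNReal.ofReal (lam f)) (constKernel S lam) where
  step_of_ne_zero {f σ σ'} hne := by
    by_contra hstep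
    exact hne (if_neg hstep)
  le {f σ σ'} hstep := by
    rw [constKernel, if_pos hstep, weight_eq hω _ _ σ']
    exact mul_le_mul_left ((ENNReal.le_tsum (f := fun σ : {σ // S.Step f σ σ'} =>
      S.rho f σ σ' * (ω σ / ω σ')) ⟨σ, hstep⟩).trans (h f σ')) _
  tsum_le f σ' := by
    by_cases hex : ∃ σ, S.Step f σ σ'
    · obtain ⟨σ, hσ⟩ := hex
      have hzero : ∀ σ₂, σ₂ ≠ σ → constKernel S lam f σ₂ σ' = 0 := fun σ₂ hne =>
        if_neg fun hstep => hne (hat f σ' σ₂ σ hstep hσ)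
      rw [tsum_eq_single σ hzero]
      exact (if_pos hσ).le
    · push Not at hex
      simp [constKernel, hex]

theorem SwapWalk.eq_of_components {τ τ' : SwapWalk S adj} (h₁ : τ.σ₁ = τ'.σ₁) (hf : τ.f = τ'.f)
    (h₂ : τ.σ₂ = τ'.σ₂) (hg : τ.g = τ'.g) (h₃ : τ.σ₃ = τ'.σ₃) : τ = τ' := by
  cases τ
  cases τ'
  simp_all

/-- Kernels of non-adjacent flaws commute if swapping two consecutive steps preserves the product
of the kernels. -/
theorem tsum_kernel_comm (hs : ∀ f g, adj f g → adj g f) {K : F → Ω → Ω → ℝ≥0∞}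
    (hK : ∀ {f σ σ'}, K f σ σ' ≠ 0 → S.Step f σ σ')
    {swap : SwapWalk S adj → SwapWalk S adj} (hswap : IsSwap swap)
    (hpres : ∀ τ, K τ.f τ.σ₁ τ.σ₂ * K τ.g τ.σ₂ τ.σ₃ =
      K τ.g τ.σ₁ (swap τ).σ₂ * K τ.f (swap τ).σ₂ τ.σ₃)
    (f g : F) (hfg : ¬ adj f g) (σ₁ σ₃ : Ω) :
    ∑' σ₂, K f σ₁ σ₂ * K g σ₂ σ₃ = ∑' σ₂, K g σ₁ σ₂ * K f σ₂ σ₃ := by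
  have main : ∀ f g, ¬ adj f g →
      ∑' σ₂, K f σ₁ σ₂ * K g σ₂ σ₃ ≤ ∑' σ₂, K g σ₁ σ₂ * K f σ₂ σ₃ := by
    intro f g hfg
    let Z : Set Ω := {σ₂ | S.Step f σ₁ σ₂ ∧ S.Step g σ₂ σ₃}
    let walk : Z → SwapWalk S adj := fun σ₂ => ⟨σ₁, f, σ₂, g, σ₃, σ₂.2.1, σ₂.2.2, hfg⟩
    have hinj : Function.Injective fun σ₂ : Z => (swap (walk σ₂)).σ₂ := by
      intro σ₂ σ₂' h
      have hw : swap (walk σ₂) = swap (walk σ₂') :=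
        SwapWalk.eq_of_components ((hswap.first _).trans (hswap.first (walk σ₂')).symm)
          ((hswap.flaw₁ _).trans (hswap.flaw₁ (walk σ₂')).symm) h
          ((hswap.flaw₂ _).trans (hswap.flaw₂ (walk σ₂')).symm)
          ((hswap.last _).trans (hswap.last (walk σ₂')).symm)
      have := congrArg SwapWalk.σ₂ (hswap.injective hw)
      exact Subtype.ext this
    calc ∑' σ₂, K f σ₁ σ₂ * K g σ₂ σ₃
        = ∑' σ₂ : Z, K f σ₁ σ₂ * K g σ₂ σ₃ := by
          refine (tsum_subtype_eq_of_support_subset fun σ₂ h => ?_).symm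
          have h := (Function.mem_support.1 h)
          exact ⟨hK (left_ne_zero_of_mul h), hK (right_ne_zero_of_mul h)⟩
      _ = ∑' σ₂ : Z, K g σ₁ (swap (walk σ₂)).σ₂ * K f (swap (walk σ₂)).σ₂ σ₃ :=
          tsum_congr fun σ₂ => hpres (walk σ₂)
      _ ≤ ∑' σ₂, K g σ₁ σ₂ * K f σ₂ σ₃ :=
          ENNReal.tsum_comp_le_tsum_of_injective hinj fun σ₂ => K g σ₁ σ₂ * K f σ₂ σ₃
  exact le_antisymm (main f g hfg) (main g f fun h => hfg (hs _ _ h))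

theorem IsSwap.step₁ {swap : SwapWalk S adj → SwapWalk S adj} (hswap : IsSwap swap)
    (τ : SwapWalk S adj) : S.Step τ.g τ.σ₁ (swap τ).σ₂ := by
  rw [← hswap.flaw₁, ← hswap.first]
  exact (swap τ).step₁

theorem IsSwap.step₂ {swap : SwapWalk S adj → SwapWalk S adj} (hswap : IsSwap swap)
    (τ : SwapWalk S adj) : S.Step τ.f (swap τ).σ₂ τ.σ₃ := by
  rw [← hswap.flaw₂, ← hswap.last]
  exact (swap τ).step₂

theorem constKernel_swap {swap : SwapWalk S adj → SwapWalk S adj} (hswap : IsSwap swap)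
    (τ : SwapWalk S adj) :
    constKernel S lam τ.f τ.σ₁ τ.σ₂ * constKernel S lam τ.g τ.σ₂ τ.σ₃ =
      constKernel S lam τ.g τ.σ₁ (swap τ).σ₂ * constKernel S lam τ.f (swap τ).σ₂ τ.σ₃ := by
  simp only [constKernel, if_pos τ.step₁, if_pos τ.step₂, if_pos (hswap.step₁ τ),
    if_pos (hswap.step₂ τ)]
  exact mul_comm _ _

theorem ratioKernel_swap (hω : ∀ σ, 0 < ω σ) {swap : SwapWalk S adj → SwapWalk S adj}
    (hswap : IsSwap swap) (hprob : ∀ τ, τ.prob = (swap τ).prob) (τ : SwapWalk S adj) :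
    ratioKernel S ω τ.f τ.σ₁ τ.σ₂ * ratioKernel S ω τ.g τ.σ₂ τ.σ₃ =
      ratioKernel S ω τ.g τ.σ₁ (swap τ).σ₂ * ratioKernel S ω τ.f (swap τ).σ₂ τ.σ₃ := by
  have htel : ∀ (a b : ℝ≥0∞) (σ : Ω), a * (ω τ.σ₁ / ω σ) * (b * (ω σ / ω τ.σ₃)) =
      a * b * (ω τ.σ₁ / ω τ.σ₃) := by
    intro a b σ
    have : ω τ.σ₁ / ω σ * (ω σ / ω τ.σ₃) = ω τ.σ₁ / ω τ.σ₃ := by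
      rw [← mul_div_assoc, ENNReal.div_mul_cancel (hω σ).ne' (ω.apply_ne_top σ)]
    rw [← this]
    ring
  have hp := hprob τ
  simp only [SwapWalk.prob, hswap.first, hswap.flaw₁, hswap.flaw₂, hswap.last] at hp
  simp only [ratioKernel, if_pos τ.step₁, if_pos τ.step₂, if_pos (hswap.step₁ τ),
    if_pos (hswap.step₂ τ), htel, hp]

end Kernels

/-! ### Commutative oracles with an arbitrary strategy -/

section Commutative

variable {Ω F : Type*} [Fintype F] {S : Oracles Ω F} {adj : F → F → Prop} {ω : PMF Ω}
  {ℓ : F → ℝ≥0∞} {K : F → Ω → Ω → ℝ≥0∞}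

theorem indSets_present_subset_indInit {ωinit : PMF Ω} {σ : Ω} (hσ : σ ∈ ωinit.support) :
    indSets adj (S.present σ) ⊆ indInit S adj ωinit := fun R hR => by
  simp only [indInit, Finset.mem_filter, Finset.mem_univ, true_and]
  exact ⟨σ, hσ, hR⟩

/-- If the charge kernels of non-adjacent flaws commute, flaw sequences may be recorded up to
trace equivalence, and the trace classes that occur are represented by layered words. -/
theorem tsum_survival_le_of_comm (hadj : IsPotentialCausalityGraph S adj)
    (hK : IsChargeKernel S ω ℓ K) (hω : ∀ σ, 0 < ω σ)
    (hcomm : ∀ f g, ¬ adj f g → ∀ σ₁ σ₃,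
      ∑' σ₂, K f σ₁ σ₂ * K g σ₂ σ₃ = ∑' σ₂, K g σ₁ σ₂ * K f σ₂ σ₃)
    (Λ : Strategy S) (ωinit : PMF Ω) (n : ℕ) :
    ∑' σ, ωinit σ * survival S Λ n (.start σ) ≤ gammaInit ω ωinit *
      ∑' L : {L // Layered adj (indInit S adj ωinit) L ∧ size L = n}, layerWeight ℓ L.1 := by
  have he : ∀ I : Finset F, I.toList.Perm I.toList := fun I => .refl _
  let st := traceSetoid adj hadj.symm
  let v : Quotient st → Ω → ℝ≥0∞ :=
    Quotient.lift (wordCharge ω K) fun V W h => funext fun σ => wordCharge_congr hcomm h σ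
  let len : Quotient st → ℕ := Quotient.lift List.length fun V W h => TraceEq.perm h |>.length_eq
  let cons : F → Quotient st → Quotient st := fun f =>
    Quotient.map (f :: ·) fun V W h => TraceEq.cons f h
  refine tsum_survival_le hK Λ hω ωinit v cons ?_ ?_ (fun n _ => {c | len c = n}) ?_ ?_ n
    (fun L => Quotient.mk st (spell Finset.toList L)) ?_ ?_
  · intro f c d
    induction c, d using Quotient.inductionOn₂ with
    | _ V W =>
    intro h
    exact Quotient.sound (TraceEq.cons_cancel (Quotient.exact h))
  · intro f c σ
    induction c using Quotient.inductionOn with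
    | _ W => rfl
  · exact fun h => ⟨Quotient.mk st [], rfl, rfl⟩
  · intro n h hne f σ' _ _ c hc
    induction c using Quotient.inductionOn with
    | _ W => exact congrArg (· + 1) hc
  · intro L
    rw [← prod_spell he]
    exact hK.tsum_wordCharge_le _
  · intro σ hσ c hc hv
    induction c using Quotient.inductionOn with
    | _ W =>
    obtain ⟨L, hL, hWL⟩ := (hK.feasible hadj hv).exists_layered hadj.symm he
    refine ⟨L, ⟨hL.mono (indSets_present_subset_indInit hσ), ?_⟩, (Quotient.sound hWL).symm⟩
    rw [← length_spell he, ← hWL.perm.length_eq]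
    exact hc

end Commutative

/-! ### The stable strategy -/

section Stable

variable {Ω F : Type*} [Fintype F] [LinearOrder F] {S : Oracles Ω F} {adj : F → F → Prop}
  {ω : PMF Ω} {ℓ : F → ℝ≥0∞} {K : F → Ω → Ω → ℝ≥0∞}

/-- The flaw sequences of length `n` with which a stable execution can continue after `h`: the
remainder `B` of the current round in increasing order, and then complete rounds `L`. They are
restricted only for histories in which every addressed flaw of the current round that is present
again is a neighbour of an addressed flaw. -/
def stableWords (S : Oracles Ω F) (adj : F → F → Prop) (n : ℕ) (h : History Ω F) :
    Set (List F) :=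
  {W | W.length = n ∧ (S.present h.last ∩ roundSet S adj h ⊆ nbrs adj (roundSet S adj h) →
    ∃ (B : Finset F) (L : List (Finset F)), W = B.sort (· ≤ ·) ++ spell (·.sort (· ≤ ·)) L ∧
      (B : Set F) ⊆ eligible S adj h ∧ Indep adj (B : Set F) ∧ (B = ∅ → L = []) ∧
      Layered adj (indSets adj (nbrs adj (roundSet S adj h ∪ B))) L)}

/-- Addressing the lowest eligible flaw `f` prepends it either to the remainder of its round or,
if that round ends with `f`, to the rounds that follow. -/
theorem cons_mem_stableWords (hadj : IsPotentialCausalityGraph S adj) {n : ℕ} {h : History Ω F}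
    {f : F} {σ : Ω} (hf : f ∈ eligible S adj h) (hmin : ∀ g ∈ eligible S adj h, f ≤ g)
    (hstep : S.Step f h.last σ) {W : List F} (hW : W ∈ stableWords S adj n (h.step f σ)) :
    f :: W ∈ stableWords S adj (n + 1) h := by
  obtain ⟨hlen, hW⟩ := hW
  refine ⟨by simp [hlen], fun hinv => ?_⟩
  have hcaus := hadj.causality f h.last σ hstep
  have hinv' : S.present σ ∩ insert f (roundSet S adj h) ⊆
      nbrs adj (insert f (roundSet S adj h)) := by
    rintro g ⟨hg, hgJ⟩
    rcases hcaus hg with ⟨hg, hgf⟩ | hg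
    · obtain ⟨x, hx, hxg⟩ := hinv ⟨hg, hgJ.resolve_left hgf⟩
      exact ⟨x, .inr hx, hxg⟩
    · exact ⟨f, .inl rfl, hg⟩
  by_cases hne : (S.present σ \ nbrPlus adj (insert f (roundSet S adj h))).Nonempty
  · -- The round continues, and the remaining flaws were already eligible before this step.
    have hround : roundSet S adj (h.step f σ) = insert f (roundSet S adj h) := by
      rw [roundSet, if_pos hne]
    obtain ⟨B, L, rfl, hB, hBi, hBL, hL⟩ := hW (by rw [hround]; exact hinv')
    rw [eligible, hround] at hB
    rw [hround] at hL
    have hBf : ∀ g ∈ B, g ∈ eligible S adj h ∧ g ≠ f ∧ ¬ adj f g := by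
      intro g hg
      obtain ⟨hgσ, hgJ⟩ := hB hg
      have hfg : ¬ adj f g := fun hfg => hgJ ⟨f, .inl rfl, .inr hfg⟩
      have hgf : g ≠ f := fun hgf => hgJ ⟨f, .inl rfl, .inl hgf⟩
      rcases hcaus hgσ with hgσ | hgσ
      · refine ⟨⟨hgσ.1, fun ⟨x, hx, hxg⟩ => hgJ ⟨x, .inr hx, hxg⟩⟩, hgf, hfg⟩
      · exact absurd hgσ hfg
    refine ⟨insert f B, L, ?_, ?_, ?_, ?_, ?_⟩
    · rw [Finset.sort_insert _ (fun g hg => hmin g (hBf g hg).1) fun hfB => (hBf f hfB).2.1 rfl]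
      rfl
    · rw [Finset.coe_insert]
      exact Set.insert_subset hf fun g hg => (hBf g hg).1
    · rw [Finset.coe_insert]
      exact hBi.insert fun g hg _ =>
        ⟨(hBf g hg).2.2, fun hgf => (hBf g hg).2.2 (hadj.symm _ _ hgf)⟩
    · exact fun h => absurd h (Finset.insert_ne_empty f B)
    · rwa [Finset.coe_insert, Set.union_insert, ← Set.insert_union]
  · -- The round ends, and `B` is the complete next round.
    have hround : roundSet S adj (h.step f σ) = ∅ := by
      rw [roundSet, if_neg hne]
    obtain ⟨B, L, rfl, hB, hBi, hBL, hL⟩ := hW (by simp [hround])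
    have hσ : S.present σ ⊆ nbrs adj (roundSet S adj h ∪ {f}) := by
      intro g hg
      rw [Set.union_singleton]
      have hg' : g ∈ nbrPlus adj (insert f (roundSet S adj h)) := by
        by_contra hg'
        exact hne ⟨g, hg, hg'⟩
      obtain ⟨x, hx, rfl | hxg⟩ := hg'
      · exact hinv' ⟨hg, hx⟩
      · exact ⟨x, hx, hxg⟩
    have hB' : (B : Set F) ⊆ S.present σ := fun g hg => (hB hg).1
    rw [hround, Set.empty_union] at hL
    by_cases hBe : B = ∅
    · refine ⟨{f}, [], ?_, by simpa using hf, by simp [Indep], by simp, trivial⟩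
      simp [hBL hBe, hBe, spell]
    · refine ⟨{f}, B :: L, ?_, by simpa using hf, by simp [Indep], by simp, ?_, ?_, hL⟩
      · simp [spell]
      · rw [Finset.coe_singleton]
        exact mem_indSets.2 ⟨hB'.trans hσ, hBi⟩
      · exact Finset.nonempty_iff_ne_empty.2 hBe

theorem tsum_survival_le_of_stable (hadj : IsPotentialCausalityGraph S adj)
    (hK : IsChargeKernel S ω ℓ K) (hω : ∀ σ, 0 < ω σ) (Λ : Strategy S)
    (hΛ : ∀ h hne, ∀ f ∈ (Λ.select h hne).support,
      f ∈ eligible S adj h ∧ ∀ g ∈ eligible S adj h, f ≤ g)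
    (ωinit : PMF Ω) (n : ℕ) :
    ∑' σ, ωinit σ * survival S Λ n (.start σ) ≤ gammaInit ω ωinit *
      ∑' L : {L // Layered adj (indInit S adj ωinit) L ∧ size L = n}, layerWeight ℓ L.1 := by
  have he : ∀ I : Finset F, (I.sort (· ≤ ·)).Perm I.toList := fun I =>
    Finset.sort_perm_toList I _
  refine tsum_survival_le hK Λ hω ωinit (wordCharge ω K) List.cons
    (fun f => List.cons_injective) (fun _ _ _ => rfl) (stableWords S adj)
    (fun h => ⟨[], ⟨rfl, fun _ => ⟨∅, [], ?_⟩⟩, rfl⟩)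
    (fun n h hne f σ hf hstep W hW =>
      cons_mem_stableWords hadj (hΛ h hne f hf).1 (hΛ h hne f hf).2 hstep hW)
    n (spell (·.sort (· ≤ ·))) (fun L => ?_) ?_
  · simp [spell, Indep, Layered]
  · rw [← prod_spell he]
    exact hK.tsum_wordCharge_le _
  · rintro σ hσ W ⟨hlen, hW⟩ -
    obtain ⟨B, L, rfl, hB, hBi, hBL, hL⟩ := hW (by simp [roundSet])
    by_cases hBe : B = ∅
    · have hL' := hBL hBe
      subst hBe hL'
      exact ⟨[], ⟨trivial, by simpa [spell, size] using hlen⟩, by simp [spell]⟩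
    · have hBL : B.sort (· ≤ ·) ++ spell (·.sort (· ≤ ·)) L =
          spell (·.sort (· ≤ ·)) (B :: L) := by simp [spell]
      rw [hBL, length_spell he] at hlen
      refine ⟨B :: L, ⟨⟨?_, Finset.nonempty_iff_ne_empty.2 hBe, ?_⟩, hlen⟩, hBL.symm⟩
      · exact indSets_present_subset_indInit hσ
          (mem_indSets.2 ⟨fun g hg => (hB hg).1, hBi⟩)
      · simpa [roundSet] using hL

end Stable

/-! ### From survival to running time -/

section RunningTime

variable {Ω F : Type*} [Fintype F] {S : Oracles Ω F} {adj : F → F → Prop} {ω ωinit : PMF Ω}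

theorem gammaInit_ne_zero : gammaInit ω ωinit ≠ 0 := by
  obtain ⟨σ, hσ⟩ := ωinit.support_nonempty
  have h : ωinit σ / ω σ ≤ gammaInit ω ωinit := le_iSup (fun σ => ωinit σ / ω σ) σ
  exact ((ENNReal.div_pos ((PMF.mem_support_iff _ _).1 hσ) (ω.apply_ne_top σ)).trans_le h).ne'

theorem empty_mem_indInit : ∅ ∈ indInit S adj ωinit := by
  obtain ⟨σ, hσ⟩ := ωinit.support_nonempty
  exact indSets_present_subset_indInit hσ (empty_mem_indSets _)

theorem indInit_subset : indInit S adj ωinit ⊆ indSets adj Set.univ := fun R hR => by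
  simp only [indInit, Finset.mem_filter, Finset.mem_univ, true_and] at hR
  obtain ⟨σ, -, hR⟩ := hR
  exact indSets_mono (Set.subset_univ _) hR

/-- The threshold `T` is the time at which the bound `γ^init θ^T ∑ μ(R)` equals one. -/
theorem one_sub_le_probFewerSteps {θ : ℝ} (hθ0 : 0 < θ) (hθ1 : θ < 1) {μ : Finset F → ℝ}
    (hμ : ∀ R, 0 ≤ μ R) (hμ1 : μ ∅ = 1) {lam : F → ℝ} (hlam : ∀ f, 0 < lam f)
    (hlayer : ∀ I ∈ indSets adj Set.univ,
      (∏ f ∈ I, lam f) * ∑ J ∈ indSets adj (nbrs adj I), μ J ≤ θ ^ I.card * μ I)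
    (hγ : gammaInit ω ωinit ≠ ⊤) (Λ : Strategy S)
    (hsurv : ∀ n, ∑' σ, ωinit σ * survival S Λ n (.start σ) ≤ gammaInit ω ωinit *
      ∑' L : {L // Layered adj (indInit S adj ωinit) L ∧ size L = n},
        layerWeight (fun f => ENNReal.ofReal (lam f)) L.1)
    {𝓘 : Finset (Finset F)} (h𝓘 : indInit S adj ωinit ⊆ 𝓘) (r : ℝ) :
    1 - θ ^ r ≤ (probFewerSteps S Λ ωinit (bigT ω ωinit θ μ 𝓘 + r)).toReal := by
  set γ := gammaInit ω ωinit with hγdef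
  set T := bigT ω ωinit θ μ 𝓘 with hT
  set n := ⌈T + r⌉₊ with hn
  set M := ∑ R ∈ 𝓘, μ R with hM
  have hMpos : 0 < M := by
    refine lt_of_lt_of_le one_pos ?_
    rw [← hμ1]
    exact Finset.single_le_sum (fun R _ => hμ R) (h𝓘 empty_mem_indInit)
  have hγpos : 0 < γ.toReal := ENNReal.toReal_pos gammaInit_ne_zero hγ
  have hsum : ∑' L : {L // Layered adj (indInit S adj ωinit) L ∧ size L = n},
      layerWeight (fun f => ENNReal.ofReal (lam f)) L.1 ≤
        ENNReal.ofReal θ ^ n * ∑ R ∈ indInit S adj ωinit, ENNReal.ofReal (μ R) := by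
    refine tsum_layerWeight_le (by simp [hμ1]) (fun I hI => ?_) n _ indInit_subset
      empty_mem_indInit
    rw [← ENNReal.ofReal_prod_of_nonneg fun f _ => (hlam f).le,
      ← ENNReal.ofReal_sum_of_nonneg fun J _ => hμ J, ← ENNReal.ofReal_pow hθ0.le,
      ← ENNReal.ofReal_mul (Finset.prod_nonneg fun f _ => (hlam f).le),
      ← ENNReal.ofReal_mul (pow_nonneg hθ0.le _)]
    exact ENNReal.ofReal_le_ofReal (hlayer I hI)
  have htail : ∑' σ, ωinit σ * survival S Λ n (.start σ) ≤
      ENNReal.ofReal (γ.toReal * (θ ^ n * M)) := by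
    refine (hsurv n).trans ?_
    rw [ENNReal.ofReal_mul hγpos.le, ENNReal.ofReal_toReal hγ,
      ENNReal.ofReal_mul (pow_nonneg hθ0.le _), ENNReal.ofReal_pow hθ0.le,
      ENNReal.ofReal_sum_of_nonneg fun J _ => hμ J]
    refine mul_le_mul_right (hsum.trans (mul_le_mul_right ?_ _)) _
    exact Finset.sum_le_sum_of_subset h𝓘
  have hexp : γ.toReal * (θ ^ n * M) ≤ θ ^ r := by
    have hlog : Real.log θ < 0 := Real.log_neg hθ0 hθ1
    have hTlog : T * Real.log θ = -(Real.log γ.toReal + Real.log M) := by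
      rw [hT, bigT, Real.log_inv, ← hγdef, ← hM]
      field_simp [hlog.ne]
    rw [← Real.log_le_log_iff (by positivity) (by positivity),
      Real.log_mul hγpos.ne' (by positivity), Real.log_mul (by positivity) hMpos.ne',
      Real.log_pow, Real.log_rpow hθ0]
    have hceil : T + r ≤ n := Nat.le_ceil _
    nlinarith [mul_nonneg (sub_nonneg.2 hceil) (neg_nonneg.2 hlog.le)]
  have htop : probFewerSteps S Λ ωinit (T + r) ≠ ⊤ := by
    refine ne_top_of_le_ne_top ENNReal.one_ne_top (iSup_le fun k => ?_)
    rw [PMF.toOuterMeasure_apply]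
    exact (ENNReal.tsum_le_tsum fun h => Set.indicator_le_self _ _ _).trans
      (PMF.tsum_coe _).le
  have h1 : 1 ≤ probFewerSteps S Λ ωinit (T + r) + ENNReal.ofReal (θ ^ r) :=
    (one_le_probFewerSteps_add Λ ωinit (T + r)).trans
      (add_le_add_right (htail.trans (ENNReal.ofReal_le_ofReal hexp)) _)
  have h2 := ENNReal.toReal_mono (by simp [htop]) h1
  rw [ENNReal.toReal_add htop ENNReal.ofReal_ne_top, ENNReal.toReal_one,
    ENNReal.toReal_ofReal (by positivity)] at h2
  linarith

end RunningTime

end LLL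

end

theorem theorem1 {Ω F : Type*} [Fintype F]
    (S : LLL.Oracles Ω F) (adj : F → F → Prop) (hadj : LLL.IsPotentialCausalityGraph S adj)
    (ω : PMF Ω) (hω : ∀ σ, 0 < ω σ)
    (θ : ℝ) (hθ0 : 0 < θ) (hθ1 : θ < 1)
    (μ : Finset F → ℝ)
    (hcond :
      (∃ lam m : F → ℝ, LLL.FlawCharges S ω lam ∧ LLL.ClusterExpansion adj θ lam m ∧
        ∀ R, μ R = ∏ f ∈ R, m f) ∨
      (∃ lam p : F → ℝ, LLL.FlawCharges S ω lam ∧ LLL.ShearerVector adj p ∧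
        (∀ f, lam f ≤ θ * p f) ∧
        ∀ R, μ R = LLL.shearerQ adj p R / LLL.shearerQ adj p ∅))
    (ωinit : PMF Ω) (hγ : LLL.gammaInit ω ωinit ≠ ⊤)
    (Λ : LLL.Strategy S) (r : ℝ) :
    ((∃ π : F ≃ Fin (Fintype.card F), LLL.IsPiStable S adj π Λ) →
      1 - θ ^ r ≤ (LLL.probFewerSteps S Λ ωinit
        (LLL.bigT ω ωinit θ μ (LLL.indInit S adj ωinit) + r)).toReal) ∧
    (LLL.WeaklyCommutative S adj ∧ S.Atomic →
      1 - θ ^ r ≤ (LLL.probFewerSteps S Λ ωinit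
        (LLL.bigT ω ωinit θ μ (LLL.indInit S adj ωinit) + r)).toReal) ∧
    (LLL.StronglyCommutative S adj →
      1 - θ ^ r ≤ (LLL.probFewerSteps S Λ ωinit
        (LLL.bigT ω ωinit θ μ (LLL.indSets adj Set.univ) + r)).toReal) := by
  obtain ⟨hμ, hμ1, lam, hch, hlayer⟩ := LLL.layer_condition hadj.symm hω hcond
  have hratio := LLL.isChargeKernel_ratioKernel hω hch
  refine ⟨?_, ?_, ?_⟩
  · rintro ⟨π, hπ⟩
    let _ : LinearOrder F := LinearOrder.lift' π π.injective
    exact LLL.one_sub_le_probFewerSteps hθ0 hθ1 hμ hμ1 (hch.pos hω) hlayer hγ Λ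
      (LLL.tsum_survival_le_of_stable hadj hratio hω Λ hπ ωinit) subset_rfl r
  · rintro ⟨⟨swap, hswap⟩, hat⟩
    have hconst := LLL.isChargeKernel_constKernel hω hch hat
    exact LLL.one_sub_le_probFewerSteps hθ0 hθ1 hμ hμ1 (hch.pos hω) hlayer hγ Λ
      (LLL.tsum_survival_le_of_comm hadj hconst hω
        (LLL.tsum_kernel_comm hadj.symm hconst.step_of_ne_zero hswap
          (LLL.constKernel_swap hswap)) Λ ωinit) subset_rfl r
  · rintro ⟨swap, hswap, hprob⟩
    exact LLL.one_sub_le_probFewerSteps hθ0 hθ1 hμ hμ1 (hch.pos hω) hlayer hγ Λ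
      (LLL.tsum_survival_le_of_comm hadj hratio hω
        (LLL.tsum_kernel_comm hadj.symm hratio.step_of_ne_zero hswap
          (LLL.ratioKernel_swap hω hswap hprob)) Λ ωinit) LLL.indInit_subset r
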